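/- Let $n>2$ and let $C,c>0$. There are constants $K>0$ and $\varepsilon>0$, depending only on $n,C,c$, such that the following holds. Let $\Omega\subset\mathbb R^n$ be open and $p\in\Omega$. Let $J\subset[0,\infty)$ be an interval containing $0$ and let $\rho\in C^1(J)$ be positive. Put $$H'(Q)=\tfrac12\rho(Q)+Q\rho'(Q),\qquad H(Q)=\int_0^Q H'(s)\,ds\qquad(Q\in J),$$ and assume that $H'(Q)\le C\rho(Q)$ for all $Q\in J$ with $\rho'(Q)>0$, and $H'(Q)\ge c\,\rho(Q)$ for all $Q\in J$ with $\rho'(Q)<0$. Let $\omega$ and $\Gamma$ be 1-forms which are smooth on $\Omega\setminus\{p\}$, with $Q=|\omega|^2\in J$ there, and which satisfy on $\Omega\setminus\{p\}$ $$d\omega=\Gamma\wedge\omega,\qquad \delta(\rho(Q)\omega)=*\bigl(\Gamma\wedge*\rho(Q)\omega\bigr)=\rho(Q)\langle\Gamma,\omega\rangle,$$ where $\delta\alpha=-\sum_i\partial_i\alpha_i$ (in particular $\Gamma=d\eta$ is allowed). Let $f=|\nabla\Gamma|+|\Gamma|^2$ and write $H$ also for the function $x\mapsto H(|\omega(x)|^2)$.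 If $H\in L^{2n/(n-2)}(\Omega)$ and $\|f\|_{L^{n/2}(\Omega)}\le\varepsilon$, then $H$ is an $H^{1,2}$ weak solution of the inequality $$\Delta H+(-1)^{3n}\,\nabla\cdot\bigl\{*\bigl[\omega\wedge*(\rho'(Q)\,dQ\wedge\omega)\bigr]\bigr\}+K f H\ \ge\ 0$$ in a neighborhood of $p$: there is an open set $U$ with $p\in U\subset\Omega$ such that $H\in H^{1,2}(U)$ and, for every $\zeta\in C_0^\infty(U)$ with $\zeta\ge0$, the function $KfH\zeta$ and the function $\sum_{j,k}a_{jk}\,\partial_kH\,\partial_j\zeta$ are integrable on $U$ and $$\int_U\Bigl(\sum_{j,k}a_{jk}\,\partial_kH\,\partial_j\zeta-K f H\zeta\Bigr)dx\le0,\qquad a_{jk}=\delta_{jk}-\frac{\rho'(Q)}{H'(Q)}\bigl(Q\,\delta_{jk}-\omega_j\omega_k\bigr),$$ where $\partial_kH$ are the weak derivatives of $H$ on $U$, and $\sum_k a_{jk}\partial_kH$ are the components of the field $\nabla H+(-1)^{3n}*[\omega\wedge*(\rho'(Q)dQ\wedge\omega)]$ because $\rho'(Q)dQ=(\rho'(Q)/H'(Q))\,dH$.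 -/

import Mathlib

open MeasureTheory Set
open scoped ENNReal

noncomputable section

namespace HodgeFrobenius

/-! Differential forms on Euclidean space are given by their components in the standard
orthonormal coordinates: a 1-form is a map `E n → E n`, a 2-form at a point is the
antisymmetric array of its components `μ i j`. -/

/-- Euclidean space `ℝⁿ`. -/
abbrev E (n : ℕ) := EuclideanSpace ℝ (Fin n)

/-- The components `∂ᵢ αⱼ` of the derivative `∇α` of a 1-form (or vector field) at `x`. -/
def partialDeriv {n : ℕ} (α : E n → E n) (x : E n) (i j : Fin n) : ℝ :=
  (fderiv ℝ α x (EuclideanSpace.single i 1)) j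

/-- The components `(dα)ᵢⱼ = ∂ᵢ αⱼ - ∂ⱼ αᵢ` of the exterior derivative of a 1-form. -/
def extDer {n : ℕ} (α : E n → E n) (x : E n) (i j : Fin n) : ℝ :=
  partialDeriv α x i j - partialDeriv α x j i

/-- The components `(a ∧ b)ᵢⱼ = aᵢ bⱼ - aⱼ bᵢ` of the wedge product of two 1-forms. -/
def wedge {n : ℕ} (a b : E n) (i j : Fin n) : ℝ := a i * b j - a j * b i

/-- The codifferential `δα = - * d * α = - ∑ᵢ ∂ᵢ αᵢ` of a 1-form. -/
def codiff {n : ℕ} (α : E n → E n) (x : E n) : ℝ := -∑ i, partialDeriv α x i i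

/-- The contraction `∑ᵢ aᵢ μᵢⱼ` of a 2-form `μ` with the vector dual to the 1-form `a`.
In terms of the Hodge star it is `(-1)ⁿ * (a ∧ * μ)`. -/
def contract {n : ℕ} (a : E n) (μ : Fin n → Fin n → ℝ) : E n :=
  WithLp.toLp 2 (fun j => ∑ i, a i * μ i j)

/-- The quadratic form `Q(ω) = * (ω ∧ * ω) = ⟨ω, ω⟩`. -/
def quad {n : ℕ} (a : E n) : ℝ := inner ℝ a a

/-- `|∇Γ| = (∑ᵢⱼ (∂ᵢ Γⱼ)²)^(1/2)`. -/
def gradNorm {n : ℕ} (Γ : E n → E n) (x : E n) : ℝ :=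
  Real.sqrt (∑ i, ∑ j, partialDeriv Γ x i j ^ 2)

/-- The function `f = |∇Γ| + |Γ|²`. -/
def potential {n : ℕ} (Γ : E n → E n) (x : E n) : ℝ := gradNorm Γ x + ‖Γ x‖ ^ 2

/-- The derivative `ρ'(Q)` of the density, a function on the interval `J` (one-sided at the
end points that belong to `J`). -/
def dens' (J : Set ℝ) (ρ : ℝ → ℝ) (s : ℝ) : ℝ := derivWithin ρ J s

/-- `H'(Q) = ρ(Q)/2 + Q ρ'(Q)`. -/
def H' (J : Set ℝ) (ρ : ℝ → ℝ) (s : ℝ) : ℝ := ρ s / 2 + s * dens' J ρ s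

/-- The primitive `H` of `H'` with `H(0) = 0`. -/
def H (J : Set ℝ) (ρ : ℝ → ℝ) (q : ℝ) : ℝ := ∫ s in (0 : ℝ)..q, H' J ρ s

/-- Mass densities: `ρ` is positive and continuously differentiable on an interval `J` of
nonnegative numbers that contains `0` (for instance `J = [0, ∞)`, or `J = [0, b)`), and
`H' ≤ C ρ` where `ρ' > 0`, `H' ≥ c ρ` where `ρ' < 0`. -/
structure IsDensity (C c : ℝ) (J : Set ℝ) (ρ : ℝ → ℝ) : Prop where
  zero_mem : (0 : ℝ) ∈ J
  nonneg : J ⊆ Ici 0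
  interval : J.OrdConnected
  contDiff : ContDiffOn ℝ 1 ρ J
  pos : ∀ s ∈ J, 0 < ρ s
  upper : ∀ s ∈ J, 0 < dens' J ρ s → H' J ρ s ≤ C * ρ s
  lower : ∀ s ∈ J, dens' J ρ s < 0 → c * ρ s ≤ H' J ρ s

/-- The 1-forms `ω`, `Γ` are smooth on the open set `S` and satisfy there the
Hodge-Frobenius system `dω = Γ ∧ ω`, `δ(ρ(Q) ω) = * (Γ ∧ * ρ(Q) ω) = ρ(Q) ⟨Γ, ω⟩`; the values
of `Q` lie in the interval `J` on which `ρ` is given. -/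
structure IsSolution {n : ℕ} (J : Set ℝ) (ρ : ℝ → ℝ) (S : Set (E n)) (ω Γ : E n → E n) :
    Prop where
  smooth_form : ContDiffOn ℝ (⊤ : ℕ∞) ω S
  smooth_coeff : ContDiffOn ℝ (⊤ : ℕ∞) Γ S
  quad_mem : ∀ x ∈ S, quad (ω x) ∈ J
  frobenius : ∀ x ∈ S, ∀ i j, extDer ω x i j = wedge (Γ x) (ω x) i j
  hodge : ∀ x ∈ S,
    codiff (fun y => ρ (quad (ω y)) • ω y) x = ρ (quad (ω x)) * inner ℝ (Γ x) (ω x)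

/-- Test functions on an open set `U`: the space `C₀^∞(U)`. -/
structure IsTest {n : ℕ} (U : Set (E n)) (ζ : E n → ℝ) : Prop where
  smooth : ContDiff ℝ (⊤ : ℕ∞) ζ
  compact : HasCompactSupport ζ
  supp : tsupport ζ ⊆ U

/-- `G` is the weak gradient of `u` on `U`, and `u`, `G` are both square integrable there; that
is, `u ∈ H^{1,2}(U)` with `∇u = G`. -/
structure HasH12Gradient {n : ℕ} (U : Set (E n)) (u : E n → ℝ) (G : E n → E n) : Prop where
  memLp : MemLp u 2 (volume.restrict U)
  memLp_grad : MemLp G 2 (volume.restrict U)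
  weak : ∀ φ : E n → ℝ, IsTest U φ → ∀ i : Fin n,
    ∫ x in U, u x * fderiv ℝ φ x (EuclideanSpace.single i 1) = -∫ x in U, G x i * φ x

/-- `u` is an `H^{1,2}` weak subsolution of `div (A(x) ∇u) + b u = 0` on `U`, i.e. a weak
solution of the inequality `div (A(x) ∇u) + b u ≥ 0`. -/
def IsWeakSubsolution {n : ℕ} (U : Set (E n)) (A : E n → E n → E n) (b : E n → ℝ)
    (u : E n → ℝ) : Prop :=
  ∃ G : E n → E n, HasH12Gradient U u G ∧
    ∀ ζ : E n → ℝ, IsTest U ζ → (∀ x, 0 ≤ ζ x) →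
      IntegrableOn (fun x => inner ℝ (A x (G x)) (gradient ζ x)) U ∧
      IntegrableOn (fun x => b x * u x * ζ x) U ∧
      ∫ x in U, (inner ℝ (A x (G x)) (gradient ζ x) - b x * u x * ζ x) ≤ 0

/-- The flux `∇H + (-1)^{3n} * [ω ∧ * (ρ'(Q) dQ ∧ ω)]` of the operator `𝓛_ω`, as a linear
function of the gradient `v = ∇H`, where `ρ'(Q) dQ = (ρ'(Q) / H'(Q)) dH`. -/
def flux {n : ℕ} (J : Set ℝ) (ρ : ℝ → ℝ) (ω : E n → E n) (x v : E n) : E n :=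
  v + contract (ω x)
    (wedge ((dens' J ρ (quad (ω x)) / H' J ρ (quad (ω x))) • v) (ω x))

end HodgeFrobenius

end

noncomputable section

namespace HodgeFrobenius

/-! ### Mass densities -/

/-! Away from `p` the inequality is a Bochner computation. The equation for dω turns the flux of H
into (ω·∇)(ρω) + ρ(QΓ − ⟨Γ,ω⟩ω), and the second equation says div(ρω) = −ρ⟨Γ,ω⟩. The divergence of
the flux is then ρ(|∇ω|² + Q|Γ|² − 2⟨∇_ω Γ, ω⟩ + Q div Γ) + ½ρ'(Q)|∇Q|² (`bochner_identity`). Since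
|∇Q|² ≤ 4Q|∇ω|² and ρ + 2Qρ' = 2H' > 0, the terms quadratic in ∇ω have a nonnegative sum; Q|Γ|² has
the good sign; the rest is at least −(n+2)ρQ|∇Γ|, and ρQ is at most a constant times H
(`mul_dens_le_H`). Because ρ is only C¹, the field ρω has no second derivatives, and the divergence
is taken weakly (`integral_directional_deriv_mul_fderiv`).

The operator is uniformly elliptic: its matrix has eigenvalue 1 along ω and ρ/(2H') across ω, and
the density conditions bound this quotient from both sides (`le_inner_flux`, `norm_flux_le`).

The point is removed with cutoffs supported away from `p`. Testing with Hη² gives a Caccioppoli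
estimate. Its right-hand side stays bounded as the cutoffs tend to 1: by Hölder with exponents
n/(n−2) and n/2, the critical integrability H² ∈ L^{n/(n−2)} pairs with f ∈ L^{n/2} and with
|∇cutoff|², whose L^{n/2} norm is bounded by scaling. Fatou's lemma gives ∇H ∈ L² near `p`
(`memLp_gradient_of_weak`). For n > 2 a point has zero capacity, ∫|∇cutoff|² → 0, so both the
definition of the weak gradient and the inequality extend across `p`. -/

lemma continuousOn_derivWithin_of_ordConnected {J : Set ℝ} {ρ : ℝ → ℝ} (hJ : J.OrdConnected)
    (hρ : ContDiffOn ℝ 1 ρ J) : ContinuousOn (derivWithin ρ J) J := by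
  -- An interval is either at most one point, where continuity is trivial, or has interior, which
  -- makes derivatives within it unique.
  rcases J.subsingleton_or_nontrivial with hs | hs
  · exact hs.continuousOn _
  · refine hρ.continuousOn_derivWithin (uniqueDiffOn_convex hJ.convex ?_) le_rfl
    obtain ⟨a, ha, b, hb, hab⟩ := hs.exists_lt
    refine ⟨(a + b) / 2, mem_interior_iff_mem_nhds.2 ?_⟩
    exact Filter.mem_of_superset (Icc_mem_nhds (by linarith) (by linarith)) (hJ.out ha hb)

/-- The fundamental theorem of calculus relative to an interval of any shape; end points belonging
to `J` are allowed, so continuity of `g` is available only within `J`. -/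
lemma hasDerivWithinAt_integral {J : Set ℝ} (hJ : J.OrdConnected) {g : ℝ → ℝ}
    (hg : ContinuousOn g J) {a q : ℝ} (ha : a ∈ J) (hq : q ∈ J) :
    HasDerivWithinAt (fun y => ∫ s in a..y, g s) (g q) J q := by
  have hint : ∀ x ∈ J, ∀ y ∈ J, IntervalIntegrable g volume x y := fun x hx y hy =>
    (hg.mono (hJ.uIcc_subset hx hy)).intervalIntegrable
  rw [hasDerivWithinAt_iff_isLittleO, Asymptotics.isLittleO_iff]
  intro ε hε
  obtain ⟨δ, hδ, hd⟩ := Metric.continuousWithinAt_iff.1 (hg q hq) ε hε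
  filter_upwards [self_mem_nhdsWithin, mem_nhdsWithin_of_mem_nhds (Metric.ball_mem_nhds q hδ)]
    with y hy hyq
  have e : (∫ s in a..y, g s) - (∫ s in a..q, g s) - (y - q) • g q
      = ∫ s in q..y, (g s - g q) := by
    rw [intervalIntegral.integral_interval_sub_left (hint a ha y hy) (hint a ha q hq),
      intervalIntegral.integral_sub (hint q hq y hy) (by simp)]
    simp
  rw [e, Real.norm_eq_abs (y - q)]
  refine intervalIntegral.norm_integral_le_of_norm_le_const fun s hs => ?_
  have hs' : s ∈ uIcc q y := uIoc_subset_uIcc hs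
  have hsq : dist s q < δ := by
    rw [Real.dist_eq]
    have h1 : |s - q| ≤ |y - q| := abs_sub_left_of_mem_uIcc hs'
    exact h1.trans_lt (by simpa [Real.dist_eq] using hyq)
  exact (hd (hJ.uIcc_subset hq hy hs') hsq).le

namespace IsDensity

variable {C c : ℝ} {J : Set ℝ} {ρ : ℝ → ℝ}

lemma continuousOn_dens' (h : IsDensity C c J ρ) : ContinuousOn (dens' J ρ) J :=
  continuousOn_derivWithin_of_ordConnected h.interval h.contDiff

lemma continuousOn_H' (h : IsDensity C c J ρ) : ContinuousOn (H' J ρ) J :=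
  (h.contDiff.continuousOn.div_const 2).add (continuousOn_id.mul h.continuousOn_dens')

lemma hasDerivWithinAt_dens (h : IsDensity C c J ρ) {s : ℝ} (hs : s ∈ J) :
    HasDerivWithinAt ρ (dens' J ρ s) J s :=
  (h.contDiff.differentiableOn one_ne_zero s hs).hasDerivWithinAt

lemma hasDerivWithinAt_H (h : IsDensity C c J ρ) {s : ℝ} (hs : s ∈ J) :
    HasDerivWithinAt (H J ρ) (H' J ρ s) J s :=
  hasDerivWithinAt_integral h.interval h.continuousOn_H' h.zero_mem hs

/-- Where ρ' ≥ 0 the term sρ' is nonnegative and H' ≥ ρ/2; elsewhere the density condition supplies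
`c`. -/
lemma min_mul_le_H' (h : IsDensity C c J ρ) {s : ℝ} (hs : s ∈ J) :
    min (1 / 2) c * ρ s ≤ H' J ρ s := by
  have hρ := h.pos s hs
  rcases lt_or_ge (dens' J ρ s) 0 with h' | h'
  · exact (mul_le_mul_of_nonneg_right (min_le_right _ _) hρ.le).trans (h.lower s hs h')
  · refine (mul_le_mul_of_nonneg_right (min_le_left _ _) hρ.le).trans ?_
    have := mul_nonneg (h.nonneg hs) h'
    unfold H'
    linarith

lemma H'_le_max_mul (h : IsDensity C c J ρ) {s : ℝ} (hs : s ∈ J) :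
    H' J ρ s ≤ max (1 / 2) C * ρ s := by
  have hρ := h.pos s hs
  rcases lt_or_ge 0 (dens' J ρ s) with h' | h'
  · exact (h.upper s hs h').trans (mul_le_mul_of_nonneg_right (le_max_right _ _) hρ.le)
  · refine le_trans ?_ (mul_le_mul_of_nonneg_right (le_max_left _ _) hρ.le)
    have := mul_nonpos_of_nonneg_of_nonpos (h.nonneg hs) h'
    unfold H'
    linarith

lemma H'_pos (h : IsDensity C c J ρ) (hc : 0 < c) {s : ℝ} (hs : s ∈ J) : 0 < H' J ρ s :=
  (mul_pos (by positivity) (h.pos s hs)).trans_le (h.min_mul_le_H' hs)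

lemma H_nonneg (h : IsDensity C c J ρ) (hc : 0 < c) {q : ℝ} (hq : q ∈ J) : 0 ≤ H J ρ q :=
  intervalIntegral.integral_nonneg (h.nonneg hq) fun _ hs =>
    (h.H'_pos hc (h.interval.out h.zero_mem hq hs)).le

/-- With m = min(1/2, c), the difference of the two sides vanishes at 0 and has derivative H'/(2m) −
ρ/2, because H' − sρ' = ρ/2. This is nonnegative by `min_mul_le_H'`. The estimate converts the
factor ρQ of the Bochner bound into H. -/
lemma mul_dens_le_H (h : IsDensity C c J ρ) (hc : 0 < c) {q : ℝ} (hq : q ∈ J) :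
    q * ρ q ≤ (1 + 1 / (2 * min (1 / 2) c)) * H J ρ q := by
  set m := min (1 / 2) c with hm
  have hm0 : 0 < m := by positivity
  have hd : ∀ s ∈ J, HasDerivWithinAt (fun q => (1 + 1 / (2 * m)) * H J ρ q - q * ρ q)
      ((1 + 1 / (2 * m)) * H' J ρ s - (1 * ρ s + s * dens' J ρ s)) J s := fun s hs =>
    ((h.hasDerivWithinAt_H hs).const_mul _).sub
      ((hasDerivWithinAt_id s J).mul (h.hasDerivWithinAt_dens hs))
  have hmono := monotoneOn_of_deriv_nonneg h.interval.convex
    (fun s hs => (hd s hs).continuousWithinAt)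
    (fun s hs => ((hd s (interior_subset hs)).hasDerivAt
      (mem_interior_iff_mem_nhds.1 hs)).differentiableAt.differentiableWithinAt)
    (fun s hs => by
      rw [((hd s (interior_subset hs)).hasDerivAt (mem_interior_iff_mem_nhds.1 hs)).deriv]
      have h1 := h.min_mul_le_H' (interior_subset hs)
      have h2 : 1 / (2 * m) * H' J ρ s ≥ 1 / (2 * m) * (m * ρ s) := by gcongr
      have h3 : 1 / (2 * m) * (m * ρ s) = ρ s / 2 := by field_simp
      have h4 : H' J ρ s = ρ s / 2 + s * dens' J ρ s := rfl
      linarith)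
  have := hmono h.zero_mem hq (h.nonneg hq)
  simp only [H, intervalIntegral.integral_same] at this ⊢
  linarith

end IsDensity

/-! ### Integration by parts against test functions -/

section Support

variable {V : Type*} [NormedAddCommGroup V] [NormedSpace ℝ V]

lemma continuous_mul_of_tsupport_subset {X : Type*} [TopologicalSpace X] {S : Set X}
    (hS : IsOpen S) {u φ : X → ℝ} (hu : ContinuousOn u S) (hφ : Continuous φ)
    (hs : tsupport φ ⊆ S) : Continuous (fun x => u x * φ x) :=
  continuous_of_tsupport fun _ hx =>
    (hu.continuousAt (hS.mem_nhds (hs (tsupport_mul_subset_right hx)))).mul hφ.continuousAt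

lemma integrable_mul_of_tsupport_subset {X : Type*} [TopologicalSpace X] [MeasurableSpace X]
    [OpensMeasurableSpace X] {μ : Measure X} [IsFiniteMeasureOnCompacts μ] {S : Set X}
    (hS : IsOpen S) {u φ : X → ℝ} (hu : ContinuousOn u S) (hφ : Continuous φ)
    (hc : HasCompactSupport φ) (hs : tsupport φ ⊆ S) : Integrable (fun x => u x * φ x) μ :=
  (continuous_mul_of_tsupport_subset hS hu hφ hs).integrable_of_hasCompactSupport hc.mul_left

lemma contDiff_mul_of_tsupport_subset {S : Set V} (hS : IsOpen S) {u φ : V → ℝ}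
    {m : WithTop ℕ∞} (hu : ContDiffOn ℝ m u S) (hφ : ContDiff ℝ m φ) (hs : tsupport φ ⊆ S) :
    ContDiff ℝ m (fun x => u x * φ x) := by
  rw [contDiff_iff_contDiffAt]
  intro x
  by_cases hx : x ∈ tsupport φ
  · exact (hu.contDiffAt (hS.mem_nhds (hs hx))).mul hφ.contDiffAt
  · have : (fun x => u x * φ x) =ᶠ[nhds x] fun _ => 0 := by
      filter_upwards [notMem_tsupport_iff_eventuallyEq.1 hx] with y hy
      simp [hy]
    exact contDiffAt_const.congr_of_eventuallyEq this

lemma continuousOn_fderiv_apply {W : Type*} [NormedAddCommGroup W] [NormedSpace ℝ W]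
    {S : Set V} (hS : IsOpen S) {u : V → W} (hu : ContDiffOn ℝ 1 u S) (v : V) :
    ContinuousOn (fun x => fderiv ℝ u x v) S :=
  (hu.continuousOn_fderiv_of_isOpen hS le_rfl).clm_apply continuousOn_const

lemma tsupport_fderiv_apply_subset' (φ : V → ℝ) (v : V) :
    tsupport (fun x => fderiv ℝ φ x v) ⊆ tsupport φ :=
  tsupport_fderiv_apply_subset ℝ v

variable [FiniteDimensional ℝ V] [MeasurableSpace V] [BorelSpace V] {μ : Measure V}
  [μ.IsAddHaarMeasure]

/-- There is no boundary term even though `u` may be singular outside `S`: the products extend by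
zero to continuous functions of compact support. -/
lemma integral_mul_fderiv_of_tsupport_subset {S : Set V} (hS : IsOpen S) {u φ : V → ℝ}
    (hu : ContDiffOn ℝ 1 u S) (hφ : ContDiff ℝ 1 φ) (hc : HasCompactSupport φ)
    (hs : tsupport φ ⊆ S) (v : V) :
    ∫ x, u x * fderiv ℝ φ x v ∂μ = -∫ x, fderiv ℝ u x v * φ x ∂μ := by
  refine integral_mul_fderiv_eq_neg_fderiv_mul_of_integrable
    (integrable_mul_of_tsupport_subset hS (continuousOn_fderiv_apply hS hu v) hφ.continuous hc hs)
    (integrable_mul_of_tsupport_subset hS hu.continuousOn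
      ((hφ.continuous_fderiv one_ne_zero).clm_apply continuous_const)
      (hc.fderiv_apply (𝕜 := ℝ) v)
      ((tsupport_fderiv_apply_subset' φ v).trans hs))
    (integrable_mul_of_tsupport_subset hS hu.continuousOn hφ.continuous hc hs)
    (fun x hx => (hu.contDiffAt (hS.mem_nhds (hs hx))).differentiableAt one_ne_zero)
    (fun x _ => (hφ.differentiable one_ne_zero) x)

/-- Since `u` is only C¹, both derivatives are moved to `ψ`, where the second derivative is
symmetric. This replaces the interchange of second derivatives of `u`. -/
lemma integral_fderiv_mul_fderiv_comm {S : Set V} (hS : IsOpen S) {u ψ : V → ℝ}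
    (hu : ContDiffOn ℝ 1 u S) (hψ : ContDiff ℝ 2 ψ) (hc : HasCompactSupport ψ)
    (hs : tsupport ψ ⊆ S) (a b : V) :
    ∫ x, fderiv ℝ u x a * fderiv ℝ ψ x b ∂μ = ∫ x, fderiv ℝ u x b * fderiv ℝ ψ x a ∂μ := by
  have hd : ∀ v, ContDiff ℝ 1 (fun x => fderiv ℝ ψ x v) := fun v =>
    (hψ.fderiv_right (m := 1) (by norm_num)).clm_apply contDiff_const
  have key : ∀ v w, ∫ x, fderiv ℝ u x v * fderiv ℝ ψ x w ∂μ
      = -∫ x, u x * fderiv ℝ (fun y => fderiv ℝ ψ y w) x v ∂μ := fun v w => by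
    rw [integral_mul_fderiv_of_tsupport_subset hS hu (hd w) (hc.fderiv_apply (𝕜 := ℝ) w)
      ((tsupport_fderiv_apply_subset' ψ w).trans hs) v, neg_neg]
  rw [key a b, key b a]
  congr 2
  ext x
  have h2 : ∀ v w, fderiv ℝ (fun y => fderiv ℝ ψ y w) x v = fderiv ℝ (fderiv ℝ ψ) x v w := by
    intro v w
    have hdx : DifferentiableAt ℝ (fderiv ℝ ψ) x :=
      ((hψ.fderiv_right (m := 1) (by norm_num)).differentiable one_ne_zero) x
    rw [fderiv_clm_apply hdx (differentiableAt_const w)]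
    simp
  rw [h2, h2, (hψ.contDiffAt.isSymmSndFDerivAt (by simp)).eq a b]

end Support

lemma fderiv_coord {n : ℕ} {α : E n → E n} {x : E n} (h : DifferentiableAt ℝ α x) (j : Fin n)
    (v : E n) : fderiv ℝ (fun y => α y j) x v = (fderiv ℝ α x v) j := by
  have := ((EuclideanSpace.proj (𝕜 := ℝ) j).hasFDerivAt.comp x
    h.hasFDerivAt).fderiv
  have h2 : (fun y => α y j) = (EuclideanSpace.proj (𝕜 := ℝ) j) ∘ α := by
    ext; simp
  rw [h2, this]
  simp

lemma contDiffOn_coord {n : ℕ} {S : Set (E n)} {m : WithTop ℕ∞} {α : E n → E n}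
    (h : ContDiffOn ℝ m α S) (j : Fin n) : ContDiffOn ℝ m (fun y => α y j) S :=
  (contDiffOn_piLp 2).1 h j

/-- The weak form of `div ((w · ∇) X) = ∑ ∂ₖ wᵢ ∂ᵢ Xₖ + w · ∇ (div X)` for fields `X` which are
only continuously differentiable. -/
lemma integral_directional_deriv_mul_fderiv {n : ℕ} {S : Set (E n)} (hS : IsOpen S)
    {w X : E n → E n} {D : E n → ℝ} (hw : ContDiffOn ℝ (⊤ : ℕ∞) w S) (hX : ContDiffOn ℝ 1 X S)
    (hD : ContDiffOn ℝ 1 D S) (hdiv : ∀ x ∈ S, ∑ k, partialDeriv X x k k = D x)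
    {φ : E n → ℝ} (hφ : IsTest S φ) :
    ∫ x, ∑ i, ∑ k, w x i * partialDeriv X x i k * fderiv ℝ φ x (EuclideanSpace.single k 1) =
      -∫ x, (∑ i, ∑ k, partialDeriv w x k i * partialDeriv X x i k +
        ∑ i, w x i * fderiv ℝ D x (EuclideanSpace.single i 1)) * φ x := by
  have hwc := fun i => contDiffOn_coord hw i
  have hXc := fun i => contDiffOn_coord hX i
  have cX : ∀ i k, ContinuousOn (fun x => partialDeriv X x i k) S := fun i k =>
    (continuousOn_fderiv_apply hS (hXc k) (EuclideanSpace.single i 1)).congr fun x hx =>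
      (fderiv_coord ((hX.contDiffAt (hS.mem_nhds hx)).differentiableAt one_ne_zero) k _).symm
  have cw : ∀ i k, ContinuousOn (fun x => partialDeriv w x i k) S := fun i k =>
    (continuousOn_fderiv_apply hS ((hwc k).of_le (by exact_mod_cast le_top))
      (EuclideanSpace.single i 1)).congr fun x hx =>
      (fderiv_coord ((hw.contDiffAt (hS.mem_nhds hx)).differentiableAt (by simp)) k _).symm
  have cD : ∀ i : Fin n, ContinuousOn (fun x => fderiv ℝ D x (EuclideanSpace.single i 1)) S :=
    fun i => continuousOn_fderiv_apply hS hD _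
  have hφ1 : ContDiff ℝ 1 φ := hφ.smooth.of_le (by exact_mod_cast le_top)
  have cdφ : ∀ v, Continuous (fun x => fderiv ℝ φ x v) := fun v =>
    (hφ1.continuous_fderiv one_ne_zero).clm_apply continuous_const
  have I1 : ∀ u : E n → ℝ, ContinuousOn u S → Integrable (fun x => u x * φ x) := fun u hu =>
    integrable_mul_of_tsupport_subset hS hu hφ.smooth.continuous hφ.compact hφ.supp
  have I2 : ∀ u : E n → ℝ, ContinuousOn u S → ∀ v, Integrable (fun x => u x * fderiv ℝ φ x v) :=
    fun u hu v => integrable_mul_of_tsupport_subset hS hu (cdφ v)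
      (hφ.compact.fderiv_apply (𝕜 := ℝ) v) ((tsupport_fderiv_apply_subset' φ v).trans hφ.supp)
  have h2top : (2 : WithTop ℕ∞) ≤ ((⊤ : ℕ∞) : WithTop ℕ∞) :=
    (mod_cast le_top : ((2 : ℕ∞) : WithTop ℕ∞) ≤ _)
  have hψ : ∀ i, ContDiff ℝ 2 (fun x => w x i * φ x) := fun i =>
    contDiff_mul_of_tsupport_subset hS ((hwc i).of_le h2top)
      (hφ.smooth.of_le h2top) hφ.supp
  have hψc : ∀ i, HasCompactSupport (fun x => w x i * φ x) := fun i => hφ.compact.mul_left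
  have hψs : ∀ i, tsupport (fun x => w x i * φ x) ⊆ S := fun i =>
    tsupport_mul_subset_right.trans hφ.supp
  have hprod : ∀ i, ∀ x ∈ S, ∀ v, fderiv ℝ (fun x => w x i * φ x) x v
      = w x i * fderiv ℝ φ x v + (fderiv ℝ w x v) i * φ x := fun i x hx v => by
    have hwx : DifferentiableAt ℝ w x := (hw.contDiffAt (hS.mem_nhds hx)).differentiableAt (by simp)
    have hwi : DifferentiableAt ℝ (fun y => w y i) x :=
      ((hwc i).contDiffAt (hS.mem_nhds hx)).differentiableAt (by simp)
    rw [fderiv_fun_mul hwi ((hφ1.differentiable one_ne_zero) x)]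
    simp only [add_apply, smul_apply, smul_eq_mul,
      fderiv_coord hwx]
    ring
  have hzero : ∀ x ∉ S, φ x = 0 := fun x hx => image_eq_zero_of_notMem_tsupport
    fun h => hx (hφ.supp h)
  have hdzero : ∀ x ∉ S, ∀ v, fderiv ℝ φ x v = 0 := fun x hx v =>
    image_eq_zero_of_notMem_tsupport (f := fun x => fderiv ℝ φ x v) fun h =>
      hx (hφ.supp (tsupport_fderiv_apply_subset' φ v h))
  have hψzero : ∀ i, ∀ x ∉ S, ∀ v, fderiv ℝ (fun x => w x i * φ x) x v = 0 := fun i x hx v =>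
    image_eq_zero_of_notMem_tsupport
      (f := fun x => fderiv ℝ (fun x => w x i * φ x) x v) fun h => hx (hψs i (tsupport_fderiv_apply_subset' _ v h))
  have Iψ : ∀ u : E n → ℝ, ContinuousOn u S → ∀ i v,
      Integrable (fun x => u x * fderiv ℝ (fun x => w x i * φ x) x v) := fun u hu i v =>
    integrable_mul_of_tsupport_subset hS hu
      (((hψ i).continuous_fderiv (by norm_num)).clm_apply continuous_const)
      ((hψc i).fderiv_apply (𝕜 := ℝ) v) ((tsupport_fderiv_apply_subset' _ v).trans (hψs i))
  have step : ∀ i, ∫ x, ∑ k, w x i * partialDeriv X x i k *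
        fderiv ℝ φ x (EuclideanSpace.single k 1)
      = -∫ x, (∑ k, partialDeriv w x k i * partialDeriv X x i k +
        w x i * fderiv ℝ D x (EuclideanSpace.single i 1)) * φ x := by
    intro i
    -- The product rule absorbs the weight into the test function: wᵢ ∂ₖφ = ∂ₖ(wᵢφ) − φ ∂ₖwᵢ.
    have e1 : (fun x => ∑ k, w x i * partialDeriv X x i k *
        fderiv ℝ φ x (EuclideanSpace.single k 1)) = fun x =>
        (∑ k, partialDeriv X x i k *
          fderiv ℝ (fun x => w x i * φ x) x (EuclideanSpace.single k 1)) -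
        (∑ k, partialDeriv w x k i * partialDeriv X x i k) * φ x := by
      ext x
      rw [Finset.sum_mul, ← Finset.sum_sub_distrib]
      refine Finset.sum_congr rfl fun k _ => ?_
      by_cases hx : x ∈ S
      · rw [hprod i x hx]
        simp only [partialDeriv]
        ring
      · rw [hdzero x hx, hψzero i x hx, hzero x hx]
        ring
    -- Exchanging the two directions turns ∂ᵢXₖ into ∂ₖXₖ, whose sum over k is the divergence `D`;
    -- `D` is C¹ and can be integrated by parts.
    have e2 : ∀ k, ∫ x, partialDeriv X x i k *
          fderiv ℝ (fun x => w x i * φ x) x (EuclideanSpace.single k 1)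
        = ∫ x, partialDeriv X x k k *
          fderiv ℝ (fun x => w x i * φ x) x (EuclideanSpace.single i 1) := by
      intro k
      have := integral_fderiv_mul_fderiv_comm (μ := volume) hS (hXc k) (hψ i) (hψc i) (hψs i)
        (EuclideanSpace.single i 1) (EuclideanSpace.single k 1)
      refine Eq.trans (integral_congr_ae (.of_forall fun x => ?_))
        (this.trans (integral_congr_ae (.of_forall fun x => ?_)))
      all_goals
        by_cases hx : x ∈ S
        · have hXx : DifferentiableAt ℝ X x :=
            (hX.contDiffAt (hS.mem_nhds hx)).differentiableAt one_ne_zero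
          simp only [fderiv_coord hXx, partialDeriv]
        · simp only [hψzero i x hx, mul_zero]
    have e3 : ∫ x, ∑ k, partialDeriv X x k k *
          fderiv ℝ (fun x => w x i * φ x) x (EuclideanSpace.single i 1)
        = -∫ x, fderiv ℝ D x (EuclideanSpace.single i 1) * (w x i * φ x) := by
      rw [← integral_mul_fderiv_of_tsupport_subset hS hD ((hψ i).of_le (by norm_num)) (hψc i)
        (hψs i)]
      refine integral_congr_ae (.of_forall fun x => ?_)
      by_cases hx : x ∈ S
      · simp only [← Finset.sum_mul, hdiv x hx]
      · simp [hψzero i x hx]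
    have c1 : ContinuousOn (fun x => ∑ k, partialDeriv w x k i * partialDeriv X x i k) S :=
      continuousOn_finsetSum _ fun k _ => (cw k i).mul (cX i k)
    have c2 : ContinuousOn (fun x => w x i * fderiv ℝ D x (EuclideanSpace.single i 1)) S :=
      (hwc i).continuousOn.mul (cD i)
    rw [e1, integral_sub (integrable_finsetSum _ fun k _ => Iψ _ (cX i k) i _) (I1 _ c1),
      integral_finsetSum _ (fun k _ => Iψ _ (cX i k) i _)]
    simp_rw [e2]
    rw [← integral_finsetSum _ (fun k _ => Iψ _ (cX k k) i _), e3]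
    have e4 : ∫ x, (∑ k, partialDeriv w x k i * partialDeriv X x i k +
        w x i * fderiv ℝ D x (EuclideanSpace.single i 1)) * φ x
        = (∫ x, (∑ k, partialDeriv w x k i * partialDeriv X x i k) * φ x) +
          ∫ x, fderiv ℝ D x (EuclideanSpace.single i 1) * (w x i * φ x) := by
      rw [← integral_add (I1 _ c1)]
      · refine integral_congr_ae (.of_forall fun x => ?_)
        simp only
        ring
      · refine (I1 _ c2).congr (.of_forall fun x => ?_)
        simp only
        ring
    rw [e4]
    ring
  have c1 : ∀ i, ContinuousOn (fun x => ∑ k, partialDeriv w x k i * partialDeriv X x i k +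
      w x i * fderiv ℝ D x (EuclideanSpace.single i 1)) S := fun i =>
    (continuousOn_finsetSum _ fun k _ => (cw k i).mul (cX i k)).add
      ((hwc i).continuousOn.mul (cD i))
  rw [integral_finsetSum _ fun i _ => integrable_finsetSum _ fun k _ =>
    I2 (fun x => w x i * partialDeriv X x i k) ((hwc i).continuousOn.mul (cX i k)) _]
  simp_rw [step]
  rw [Finset.sum_neg_distrib, ← integral_finsetSum _ fun i _ => I1 _ (c1 i)]
  simp only [← Finset.sum_mul, Finset.sum_add_distrib]

/-! ### The Bochner identity at a point -/

section Bochner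

variable {n : ℕ} {a g : Fin n → Fin n → ℝ} {w γ P : Fin n → ℝ}

/-- Expanding |a − aᵀ|² gives 2|a|² − 2 tr(a²), while Lagrange's identity evaluates |γ ∧ w|². -/
lemma sum_mul_transpose_of_curl (hcurl : ∀ i j, a i j - a j i = γ i * w j - γ j * w i) :
    ∑ i, ∑ k, a k i * a i k = (∑ i, ∑ k, a i k ^ 2)
      - ((∑ i, w i ^ 2) * (∑ i, γ i ^ 2) - (∑ i, γ i * w i) ^ 2) := by
  have h1 : ∑ i, ∑ k, (a i k - a k i) ^ 2
      = 2 * (∑ i, ∑ k, a i k ^ 2) - 2 * ∑ i, ∑ k, a k i * a i k := by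
    have hc : ∑ i, ∑ k, a k i ^ 2 = ∑ i, ∑ k, a i k ^ 2 := Finset.sum_comm
    calc _ = ∑ i, ∑ k, (a i k ^ 2 + a k i ^ 2 - 2 * (a k i * a i k)) := by
          refine Finset.sum_congr rfl fun i _ => Finset.sum_congr rfl fun k _ => by ring
      _ = _ := by
          simp only [Finset.sum_sub_distrib, Finset.sum_add_distrib, ← Finset.mul_sum, hc]
          ring
  have h2 : ∑ i, ∑ k, (γ i * w k - γ k * w i) ^ 2
      = 2 * ((∑ i, w i ^ 2) * (∑ i, γ i ^ 2)) - 2 * (∑ i, γ i * w i) ^ 2 := by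
    calc _ = ∑ i, ∑ k, (γ i ^ 2 * w k ^ 2 + w i ^ 2 * γ k ^ 2
            - 2 * ((γ i * w i) * (γ k * w k))) := by
          refine Finset.sum_congr rfl fun i _ => Finset.sum_congr rfl fun k _ => by ring
      _ = _ := by
          simp only [Finset.sum_sub_distrib, Finset.sum_add_distrib, ← Finset.mul_sum,
            ← Finset.sum_mul]
          ring
  simp only [hcurl] at h1
  linarith

/-- This is w·∇w = ½∇|w|² plus the contraction of `w` with the curl, the latter being γ ∧ w. -/
lemma sum_mul_of_curl (hP : ∀ i, P i = 2 * ∑ j, a i j * w j)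
    (hcurl : ∀ i j, a i j - a j i = γ i * w j - γ j * w i) (i : Fin n) :
    ∑ k, w k * a k i = P i / 2 - (∑ j, w j ^ 2) * γ i + (∑ j, γ j * w j) * w i := by
  have : ∀ k, w k * a k i = a i k * w k - w k ^ 2 * γ i + γ k * w k * w i := fun k => by
    linear_combination -w k * hcurl i k
  simp only [this, Finset.sum_add_distrib, Finset.sum_sub_distrib, ← Finset.sum_mul, hP]
  ring

/-- In the weak formulation the left-hand side is the divergence of the flux of `H`. -/
lemma bochner_identity (hP : ∀ i, P i = 2 * ∑ j, a i j * w j)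
    (hcurl : ∀ i j, a i j - a j i = γ i * w j - γ j * w i) (r r' : ℝ) :
    (∑ i, ∑ k, a k i * (r * a i k + r' * P i * w k))
      + (∑ i, w i * -(r' * P i * (∑ j, γ j * w j) + r * ∑ j, (g i j * w j + γ j * a i j)))
      + ((∑ k, ((r' * (∑ j, w j ^ 2) + r) * P k * γ k + r * (∑ j, w j ^ 2) * g k k))
        - r * (∑ k, (∑ j, (g k j * w j + γ j * a k j)) * w k) + r * (∑ j, γ j * w j) ^ 2)
    = r * ((∑ i, ∑ k, a i k ^ 2) + (∑ i, w i ^ 2) * (∑ i, γ i ^ 2)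
        - 2 * (∑ i, w i * ∑ j, g i j * w j) + (∑ i, w i ^ 2) * ∑ k, g k k)
      + r' / 2 * ∑ i, P i ^ 2 := by
  have hS := sum_mul_transpose_of_curl hcurl
  have hb := sum_mul_of_curl hP hcurl
  set Q := ∑ i, w i ^ 2 with hQ
  set N := ∑ j, γ j * w j with hN
  have e1 : ∑ i, ∑ k, a k i * (r * a i k + r' * P i * w k)
      = r * (∑ i, ∑ k, a k i * a i k) + r' * ∑ i, P i * ∑ k, w k * a k i := by
    simp only [Finset.mul_sum, ← Finset.sum_add_distrib]
    refine Finset.sum_congr rfl fun i _ => Finset.sum_congr rfl fun k _ => by ring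
  have e2 : ∑ i, P i * ∑ k, w k * a k i
      = (∑ i, P i ^ 2) / 2 - Q * (∑ i, P i * γ i) + N * ∑ i, P i * w i := by
    simp only [hb, Finset.mul_sum, Finset.sum_div, ← Finset.sum_add_distrib,
      ← Finset.sum_sub_distrib]
    refine Finset.sum_congr rfl fun i _ => by ring
  have e3 : ∑ i, γ i * ∑ k, w k * a k i
      = (∑ i, P i * γ i) / 2 - Q * (∑ i, γ i ^ 2) + N ^ 2 := by
    have : N ^ 2 = ∑ i, N * (γ i * w i) := by rw [← Finset.mul_sum, ← hN, sq]
    rw [this]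
    simp only [hb, Finset.mul_sum, Finset.sum_div, ← Finset.sum_add_distrib,
      ← Finset.sum_sub_distrib]
    refine Finset.sum_congr rfl fun i _ => by ring
  have e4 : ∑ k, (∑ j, (g k j * w j + γ j * a k j)) * w k
      = (∑ i, w i * ∑ j, g i j * w j) + ∑ i, γ i * ∑ k, w k * a k i := by
    have hc : ∑ i, γ i * ∑ k, w k * a k i = ∑ k, ∑ i, γ i * (w k * a k i) := by
      simp only [Finset.mul_sum]
      exact Finset.sum_comm
    rw [hc]
    simp only [Finset.mul_sum, Finset.sum_mul, ← Finset.sum_add_distrib]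
    refine Finset.sum_congr rfl fun i _ => Finset.sum_congr rfl fun k _ => by ring
  have e5 : ∑ i, w i * -(r' * P i * N + r * ∑ j, (g i j * w j + γ j * a i j))
      = -(r' * N * ∑ i, P i * w i) - r * ∑ k, (∑ j, (g k j * w j + γ j * a k j)) * w k := by
    calc _ = ∑ i, (-(r' * N * (P i * w i))
            - r * ((∑ j, (g i j * w j + γ j * a i j)) * w i)) := by
          refine Finset.sum_congr rfl fun i _ => by ring
      _ = _ := by
          rw [Finset.sum_sub_distrib, Finset.sum_neg_distrib, ← Finset.mul_sum, ← Finset.mul_sum]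
  have e6 : ∑ k, ((r' * Q + r) * P k * γ k + r * Q * g k k)
      = (r' * Q + r) * (∑ k, P k * γ k) + r * Q * ∑ k, g k k := by
    simp only [Finset.mul_sum, ← Finset.sum_add_distrib]
    refine Finset.sum_congr rfl fun i _ => by ring
  -- After substitution all multiples of P·γ, P·w and N² cancel; the Q|γ|² terms add up to a single
  -- positive one.
  rw [e5, e6, e4, e3, e1, e2, hS]
  ring

lemma abs_sum_diag_le (g : Fin n → Fin n → ℝ) :
    |∑ k, g k k| ≤ n * Real.sqrt (∑ i, ∑ j, g i j ^ 2) := by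
  refine (Finset.abs_sum_le_sum_abs _ _).trans ?_
  have : ∀ k ∈ Finset.univ, |g k k| ≤ Real.sqrt (∑ i, ∑ j, g i j ^ 2) := fun k _ => by
    refine Real.abs_le_sqrt ?_
    exact (Finset.single_le_sum (f := fun j => g k j ^ 2) (fun j _ => sq_nonneg _)
      (Finset.mem_univ k)).trans (Finset.single_le_sum (f := fun i => ∑ j, g i j ^ 2)
      (fun i _ => Finset.sum_nonneg fun j _ => sq_nonneg _) (Finset.mem_univ k))
  simpa using Finset.sum_le_card_nsmul _ _ _ this

lemma sum_sq_apply_le (a : Fin n → Fin n → ℝ) (w : Fin n → ℝ) :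
    ∑ i, (∑ j, a i j * w j) ^ 2 ≤ (∑ i, ∑ j, a i j ^ 2) * ∑ j, w j ^ 2 := by
  rw [Finset.sum_mul]
  exact Finset.sum_le_sum fun i _ => Finset.sum_mul_sq_le_sq_mul_sq _ _ _

lemma abs_bilin_le (g : Fin n → Fin n → ℝ) (w : Fin n → ℝ) :
    |∑ i, w i * ∑ j, g i j * w j| ≤ (∑ i, w i ^ 2) * Real.sqrt (∑ i, ∑ j, g i j ^ 2) := by
  have hQ : 0 ≤ ∑ i, w i ^ 2 := Finset.sum_nonneg fun i _ => sq_nonneg _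
  have hg : 0 ≤ ∑ i, ∑ j, g i j ^ 2 :=
    Finset.sum_nonneg fun i _ => Finset.sum_nonneg fun j _ => sq_nonneg _
  refine abs_le_of_sq_le_sq ?_ (by positivity)
  calc _ ≤ (∑ i, w i ^ 2) * ∑ i, (∑ j, g i j * w j) ^ 2 := Finset.sum_mul_sq_le_sq_mul_sq _ _ _
    _ ≤ (∑ i, w i ^ 2) * ((∑ i, ∑ j, g i j ^ 2) * ∑ j, w j ^ 2) := by
      gcongr
      exact sum_sq_apply_le g w
    _ = _ := by rw [mul_pow, Real.sq_sqrt hg]; ring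

/-- The factor n + 2 is n from the trace of `g` and 2 from the quadratic form ⟨w, g w⟩. The
hypothesis `hr'` is nonnegativity of 2H', which keeps the |a|² term in control when `r'` is
negative. -/
lemma bochner_lower_bound (hP : ∀ i, P i = 2 * ∑ j, a i j * w j) {r r' : ℝ} (hr : 0 < r)
    (hr' : 0 ≤ r + 2 * (∑ i, w i ^ 2) * r') :
    -((n + 2) * (r * (∑ i, w i ^ 2)) * Real.sqrt (∑ i, ∑ j, g i j ^ 2)) ≤
      r * ((∑ i, ∑ k, a i k ^ 2) + (∑ i, w i ^ 2) * (∑ i, γ i ^ 2)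
        - 2 * (∑ i, w i * ∑ j, g i j * w j) + (∑ i, w i ^ 2) * ∑ k, g k k)
      + r' / 2 * ∑ i, P i ^ 2 := by
  have hG := (abs_le.1 (abs_bilin_le g w)).2
  have hT := (abs_le.1 (abs_sum_diag_le g)).1
  have hPP : ∑ i, P i ^ 2 ≤ 4 * ((∑ i, ∑ j, a i j ^ 2) * ∑ j, w j ^ 2) := by
    have := sum_sq_apply_le a w
    simp only [hP, mul_pow, ← Finset.mul_sum]
    linarith
  have hPP0 : 0 ≤ ∑ i, P i ^ 2 := Finset.sum_nonneg fun i _ => sq_nonneg _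
  set Q := ∑ i, w i ^ 2
  set A := ∑ i, ∑ k, a i k ^ 2
  set s := Real.sqrt (∑ i, ∑ j, g i j ^ 2)
  have hQ : 0 ≤ Q := Finset.sum_nonneg fun i _ => sq_nonneg _
  have hA : 0 ≤ A := Finset.sum_nonneg fun i _ => Finset.sum_nonneg fun j _ => sq_nonneg _
  have hγ : 0 ≤ ∑ i, γ i ^ 2 := Finset.sum_nonneg fun i _ => sq_nonneg _
  -- For r' < 0 the bound |P|² ≤ 4AQ leaves at least A(r + 2Qr').
  have h1 : 0 ≤ r * A + r' / 2 * ∑ i, P i ^ 2 := by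
    rcases le_or_gt 0 r' with h | h
    · positivity
    · have h2 : r' / 2 * (4 * (A * Q)) ≤ r' / 2 * ∑ i, P i ^ 2 :=
        mul_le_mul_of_nonpos_left hPP (by linarith)
      have h3 : 0 ≤ A * (r + 2 * Q * r') := mul_nonneg hA hr'
      linarith
  have h2 : 0 ≤ r * (Q * ∑ i, γ i ^ 2) := by positivity
  have h3 : r * (∑ i, w i * ∑ j, g i j * w j) ≤ r * (Q * s) :=
    mul_le_mul_of_nonneg_left hG hr.le
  have h4 : r * Q * -(n * s) ≤ r * Q * ∑ k, g k k :=
    mul_le_mul_of_nonneg_left hT (by positivity)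
  linarith

end Bochner

/-! ### The differential inequality away from the singular point -/

section Coordinates

variable {n : ℕ}

lemma inner_eq_sum (a b : E n) : inner ℝ a b = ∑ i, a i * b i := by
  simp [PiLp.inner_apply, mul_comm]

lemma quad_eq_sum (a : E n) : quad a = ∑ i, a i ^ 2 := by
  simp only [quad, inner_eq_sum, sq]

lemma quad_eq_norm_sq (a : E n) : quad a = ‖a‖ ^ 2 := real_inner_self_eq_norm_sq a

lemma gradient_apply (u : E n → ℝ) (x : E n) (i : Fin n) :
    (gradient u x) i = fderiv ℝ u x (EuclideanSpace.single i 1) := by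
  rw [← inner_gradient_left, EuclideanSpace.inner_single_right]
  simp

lemma continuousOn_gradient {S : Set (E n)} (hS : IsOpen S) {u : E n → ℝ}
    (hu : ContDiffOn ℝ 1 u S) : ContinuousOn (gradient u) S :=
  (LinearIsometryEquiv.continuous _).comp_continuousOn
    (hu.continuousOn_fderiv_of_isOpen hS le_rfl)

lemma continuous_gradient {u : E n → ℝ} (hu : ContDiff ℝ 1 u) : Continuous (gradient u) :=
  (LinearIsometryEquiv.continuous _).comp (hu.continuous_fderiv one_ne_zero)

lemma norm_gradient (u : E n → ℝ) (x : E n) : ‖gradient u x‖ = ‖fderiv ℝ u x‖ :=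
  LinearIsometryEquiv.norm_map _ _

lemma tsupport_gradient_subset (u : E n → ℝ) : tsupport (gradient u) ⊆ tsupport u := by
  refine (closure_mono fun x hx => ?_).trans (tsupport_fderiv_subset ℝ (f := u))
  rw [Function.mem_support] at hx ⊢
  rwa [ne_eq, ← norm_eq_zero, ← norm_gradient, norm_eq_zero]

lemma continuousOn_partialDeriv {S : Set (E n)} (hS : IsOpen S) {α : E n → E n}
    (hα : ContDiffOn ℝ 1 α S) (i k : Fin n) : ContinuousOn (fun x => partialDeriv α x i k) S :=
  (continuousOn_fderiv_apply hS (contDiffOn_coord hα k) (EuclideanSpace.single i 1)).congr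
    fun _ hx =>
      (fderiv_coord ((hα.contDiffAt (hS.mem_nhds hx)).differentiableAt one_ne_zero) k _).symm

lemma continuousOn_potential {S : Set (E n)} (hS : IsOpen S) {Γ : E n → E n}
    (hΓ : ContDiffOn ℝ 1 Γ S) : ContinuousOn (potential Γ) S :=
  (Real.continuous_sqrt.comp_continuousOn (continuousOn_finsetSum _ fun i _ =>
    continuousOn_finsetSum _ fun j _ => (continuousOn_partialDeriv hS hΓ i j).pow 2)).add
    (hΓ.continuousOn.norm.pow 2)

lemma potential_nonneg (Γ : E n → E n) (x : E n) : 0 ≤ potential Γ x :=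
  add_nonneg (Real.sqrt_nonneg _) (sq_nonneg _)

/-- In this form the spectrum is visible: with t = ρ'/H', vectors along ω are fixed and vectors
orthogonal to ω are scaled by 1 − tQ. -/
lemma flux_eq (J : Set ℝ) (ρ : ℝ → ℝ) (ω : E n → E n) (x v : E n) :
    flux J ρ ω x v = v + (dens' J ρ (quad (ω x)) / H' J ρ (quad (ω x))) •
      ((inner ℝ (ω x) v) • ω x - quad (ω x) • v) := by
  ext k
  simp only [flux, contract, wedge, PiLp.add_apply, PiLp.smul_apply, PiLp.sub_apply, smul_eq_mul,
    inner_eq_sum, quad_eq_sum, Finset.sum_mul, mul_sub, Finset.mul_sum, Finset.sum_sub_distrib]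
  congr 2 <;> exact Finset.sum_congr rfl fun i _ => by ring

end Coordinates

/-! ### Uniform ellipticity of the flux. -/

section Ellipticity

variable {n : ℕ} {C c : ℝ} {J : Set ℝ} {ρ : ℝ → ℝ} {ω : E n → E n} {x : E n}

lemma IsDensity.one_sub_div (hρ : IsDensity C c J ρ) (hc : 0 < c) {s : ℝ} (hs : s ∈ J) :
    1 - dens' J ρ s / H' J ρ s * s = ρ s / (2 * H' J ρ s) := by
  have := hρ.H'_pos hc hs
  field_simp
  simp only [H']
  ring

lemma IsDensity.le_inner_flux (hρ : IsDensity C c J ρ) (hc : 0 < c) (hx : quad (ω x) ∈ J)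
    (v : E n) : 1 / (2 * max (1 / 2) C) * ‖v‖ ^ 2 ≤ inner ℝ (flux J ρ ω x v) v := by
  have hH := hρ.H'_pos hc hx
  have h1 := hρ.one_sub_div hc hx
  have h2 := hρ.H'_le_max_mul hx
  have hr := hρ.pos _ hx
  have hq0 : 0 ≤ quad (ω x) := hρ.nonneg hx
  rw [flux_eq]
  set t := dens' J ρ (quad (ω x)) / H' J ρ (quad (ω x)) with ht
  set M := max (1 / 2) C with hM
  have hM0 : 1 / 2 ≤ M := le_max_left _ _
  have hcs : inner ℝ (ω x) v ^ 2 ≤ quad (ω x) * ‖v‖ ^ 2 := by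
    rw [quad_eq_norm_sq, ← mul_pow, ← sq_abs]
    exact pow_le_pow_left₀ (abs_nonneg _) (abs_real_inner_le_norm _ _) 2
  have e : inner ℝ (v + t • (inner ℝ (ω x) v • ω x - quad (ω x) • v)) v
      = ‖v‖ ^ 2 + t * (inner ℝ (ω x) v ^ 2 - quad (ω x) * ‖v‖ ^ 2) := by
    simp only [inner_add_left, inner_sub_left, real_inner_smul_left, real_inner_self_eq_norm_sq]
    ring
  rw [e]
  -- For t ≥ 0 the smaller eigenvalue is 1 − tQ = ρ/(2H') ≥ 1/(2M); for t < 0 it is 1, by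
  -- Cauchy–Schwarz, and 1/(2M) ≤ 1 since M ≥ 1/2.
  rcases le_or_gt 0 t with h | h
  · have h3 : 1 / (2 * M) ≤ 1 - t * quad (ω x) := by
      rw [h1, div_le_div_iff₀ (by positivity) (by positivity)]
      linarith
    have h4 : 0 ≤ t * inner ℝ (ω x) v ^ 2 := by positivity
    have h5 := mul_le_mul_of_nonneg_right h3 (sq_nonneg ‖v‖)
    linarith
  · have h3 : 1 / (2 * M) ≤ 1 := by
      rw [div_le_one (by positivity)]
      linarith
    have h4 : 0 ≤ t * (inner ℝ (ω x) v ^ 2 - quad (ω x) * ‖v‖ ^ 2) :=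
      mul_nonneg_of_nonpos_of_nonpos h.le (by linarith)
    have h5 := mul_le_mul_of_nonneg_right h3 (sq_nonneg ‖v‖)
    linarith

/-- The flux splits as (1 − tQ)v + t⟨ω,v⟩ω. The two coefficients contribute at most 1/(2m) and |t|Q
≤ 1/(2m) + 1, whose sum is 1/m + 1. -/
lemma IsDensity.norm_flux_le (hρ : IsDensity C c J ρ) (hc : 0 < c) (hx : quad (ω x) ∈ J)
    (v : E n) : ‖flux J ρ ω x v‖ ≤ (1 / min (1 / 2) c + 1) * ‖v‖ := by
  have hH := hρ.H'_pos hc hx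
  have h1 := hρ.one_sub_div hc hx
  have h2 := hρ.min_mul_le_H' hx
  have hr := hρ.pos _ hx
  have hq0 : 0 ≤ quad (ω x) := hρ.nonneg hx
  rw [flux_eq]
  set t := dens' J ρ (quad (ω x)) / H' J ρ (quad (ω x)) with ht
  set m := min (1 / 2) c with hm
  have hm0 : 0 < m := by positivity
  have h3 : 1 - t * quad (ω x) ≤ 1 / (2 * m) := by
    rw [h1, div_le_div_iff₀ (by positivity) (by positivity)]
    linarith
  have h4 : 0 ≤ 1 - t * quad (ω x) := by rw [h1]; positivity
  have h5 : |t| * quad (ω x) ≤ 1 / (2 * m) + 1 := by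
    rw [← abs_of_nonneg hq0, ← abs_mul]
    exact abs_le.2 ⟨by linarith, by linarith [show 0 ≤ 1 / (2 * m) by positivity]⟩
  have e : v + t • (inner ℝ (ω x) v • ω x - quad (ω x) • v)
      = (1 - t * quad (ω x)) • v + (t * inner ℝ (ω x) v) • ω x := by
    module
  rw [e]
  calc _ ≤ ‖(1 - t * quad (ω x)) • v‖ + ‖(t * inner ℝ (ω x) v) • ω x‖ := norm_add_le _ _
    _ = (1 - t * quad (ω x)) * ‖v‖ + |t| * |inner ℝ (ω x) v| * ‖ω x‖ := by
      rw [norm_smul, norm_smul, Real.norm_of_nonneg h4, Real.norm_eq_abs, abs_mul]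
    _ ≤ 1 / (2 * m) * ‖v‖ + |t| * (‖ω x‖ * ‖v‖) * ‖ω x‖ := by
      gcongr
      exact abs_real_inner_le_norm _ _
    _ = 1 / (2 * m) * ‖v‖ + |t| * quad (ω x) * ‖v‖ := by rw [quad_eq_norm_sq]; ring
    _ ≤ 1 / (2 * m) * ‖v‖ + (1 / (2 * m) + 1) * ‖v‖ := by gcongr
    _ = _ := by field_simp; ring

end Ellipticity

/-! ### Calculus along solutions and the formula for the flux of H. -/

section WeakInequality

variable {n : ℕ} {C c : ℝ} {J : Set ℝ} {ρ : ℝ → ℝ} {S : Set (E n)} {ω Γ : E n → E n}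

namespace IsSolution

lemma contDiffOn_quad (h : IsSolution J ρ S ω Γ) :
    ContDiffOn ℝ (⊤ : ℕ∞) (fun x => quad (ω x)) S :=
  h.smooth_form.inner ℝ h.smooth_form

lemma differentiableAt_form (h : IsSolution J ρ S ω Γ) (hS : IsOpen S) {x : E n} (hx : x ∈ S) :
    DifferentiableAt ℝ ω x :=
  (h.smooth_form.contDiffAt (hS.mem_nhds hx)).differentiableAt (by simp)

lemma differentiableAt_coeff (h : IsSolution J ρ S ω Γ) (hS : IsOpen S) {x : E n} (hx : x ∈ S) :
    DifferentiableAt ℝ Γ x :=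
  (h.smooth_coeff.contDiffAt (hS.mem_nhds hx)).differentiableAt (by simp)

lemma differentiableAt_quad (h : IsSolution J ρ S ω Γ) (hS : IsOpen S) {x : E n} (hx : x ∈ S) :
    DifferentiableAt ℝ (fun x => quad (ω x)) x :=
  (h.contDiffOn_quad.contDiffAt (hS.mem_nhds hx)).differentiableAt (by simp)

lemma fderiv_quad (h : IsSolution J ρ S ω Γ) (hS : IsOpen S) {x : E n} (hx : x ∈ S) (i : Fin n) :
    fderiv ℝ (fun x => quad (ω x)) x (EuclideanSpace.single i 1)
      = 2 * ∑ j, partialDeriv ω x i j * ω x j := by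
  have hd := h.differentiableAt_form hS hx
  simp only [quad]
  rw [fderiv_inner_apply ℝ hd hd, real_inner_comm, inner_eq_sum]
  simp only [partialDeriv]
  ring

/-- A one-sided derivative of `g` at an end point of `J` suffices: Q maps the open set `S` into `J`,
so the composite has a full derivative. -/
lemma hasFDerivAt_comp (h : IsSolution J ρ S ω Γ) (hS : IsOpen S) {x : E n} (hx : x ∈ S)
    {g : ℝ → ℝ} {g' : ℝ} (hg : HasDerivWithinAt g g' J (quad (ω x))) :
    HasFDerivAt (fun y => g (quad (ω y))) (g' • fderiv ℝ (fun y => quad (ω y)) x) x := by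
  have h1 : HasFDerivWithinAt (fun y => quad (ω y)) (fderiv ℝ (fun y => quad (ω y)) x) S x :=
    (h.differentiableAt_quad hS hx).hasFDerivAt.hasFDerivWithinAt
  exact (hg.comp_hasFDerivWithinAt x h1 fun y hy => h.quad_mem y hy).hasFDerivAt (hS.mem_nhds hx)

lemma contDiffOn_comp (h : IsSolution J ρ S ω Γ) (hS : IsOpen S) {g g' : ℝ → ℝ}
    (hg : ∀ s ∈ J, HasDerivWithinAt g (g' s) J s) (hg' : ContinuousOn g' J) :
    ContDiffOn ℝ 1 (fun y => g (quad (ω y))) S := by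
  rw [show (1 : WithTop ℕ∞) = 0 + 1 by simp, contDiffOn_succ_iff_fderiv_of_isOpen hS]
  refine ⟨fun x hx => (h.hasFDerivAt_comp hS hx
    (hg _ (h.quad_mem x hx))).differentiableAt.differentiableWithinAt, by simp, ?_⟩
  rw [contDiffOn_zero]
  refine ContinuousOn.congr (f := fun x => g' (quad (ω x)) • fderiv ℝ (fun y => quad (ω y)) x) ?_
    fun x hx => (h.hasFDerivAt_comp hS hx (hg _ (h.quad_mem x hx))).fderiv
  exact (hg'.comp h.contDiffOn_quad.continuousOn h.quad_mem).smul
    (h.contDiffOn_quad.continuousOn_fderiv_of_isOpen hS (by simp))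

lemma contDiffOn_H (h : IsSolution J ρ S ω Γ) (hS : IsOpen S) (hρ : IsDensity C c J ρ) :
    ContDiffOn ℝ 1 (fun y => H J ρ (quad (ω y))) S :=
  h.contDiffOn_comp hS (fun _ hs => hρ.hasDerivWithinAt_H hs) hρ.continuousOn_H'

lemma contDiffOn_dens (h : IsSolution J ρ S ω Γ) (hS : IsOpen S) (hρ : IsDensity C c J ρ) :
    ContDiffOn ℝ 1 (fun y => ρ (quad (ω y))) S :=
  h.contDiffOn_comp hS (fun _ hs => hρ.hasDerivWithinAt_dens hs) hρ.continuousOn_dens'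

lemma continuousOn_flux (h : IsSolution J ρ S ω Γ) (hρ : IsDensity C c J ρ)
    (hc : 0 < c) {G : E n → E n} (hG : ContinuousOn G S) :
    ContinuousOn (fun x => flux J ρ ω x (G x)) S := by
  simp only [flux_eq]
  have hq := h.contDiffOn_quad.continuousOn
  have hω := h.smooth_form.continuousOn
  have hi : ContinuousOn (fun x => (inner ℝ (ω x) (G x) : ℝ)) S := hω.inner hG
  refine hG.fun_add (ContinuousOn.fun_smul ?_ ((hi.fun_smul hω).fun_sub (hq.fun_smul hG)))
  exact (hρ.continuousOn_dens'.comp hq h.quad_mem).div (hρ.continuousOn_H'.comp hq h.quad_mem)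
    fun x hx => (hρ.H'_pos hc (h.quad_mem x hx)).ne'

lemma fderiv_dens (h : IsSolution J ρ S ω Γ) (hS : IsOpen S) (hρ : IsDensity C c J ρ) {x : E n}
    (hx : x ∈ S) (v : E n) : fderiv ℝ (fun y => ρ (quad (ω y))) x v
      = dens' J ρ (quad (ω x)) * fderiv ℝ (fun y => quad (ω y)) x v := by
  rw [(h.hasFDerivAt_comp hS hx (hρ.hasDerivWithinAt_dens (h.quad_mem x hx))).fderiv]
  rfl

lemma fderiv_H (h : IsSolution J ρ S ω Γ) (hS : IsOpen S) (hρ : IsDensity C c J ρ) {x : E n}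
    (hx : x ∈ S) (v : E n) : fderiv ℝ (fun y => H J ρ (quad (ω y))) x v
      = H' J ρ (quad (ω x)) * fderiv ℝ (fun y => quad (ω y)) x v := by
  rw [(h.hasFDerivAt_comp hS hx (hρ.hasDerivWithinAt_H (h.quad_mem x hx))).fderiv]
  rfl

lemma curl_eq (h : IsSolution J ρ S ω Γ) {x : E n} (hx : x ∈ S) (i j : Fin n) :
    partialDeriv ω x i j - partialDeriv ω x j i = Γ x i * ω x j - Γ x j * ω x i :=
  h.frobenius x hx i j

lemma partialDeriv_dens_smul (h : IsSolution J ρ S ω Γ) (hS : IsOpen S) (hρ : IsDensity C c J ρ)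
    {x : E n} (hx : x ∈ S) (i k : Fin n) :
    partialDeriv (fun y => ρ (quad (ω y)) • ω y) x i k
      = ρ (quad (ω x)) * partialDeriv ω x i k + dens' J ρ (quad (ω x)) *
        fderiv ℝ (fun y => quad (ω y)) x (EuclideanSpace.single i 1) * ω x k := by
  have h1 := ((h.contDiffOn_dens hS hρ).contDiffAt (hS.mem_nhds hx)).differentiableAt one_ne_zero
  rw [partialDeriv, fderiv_fun_smul h1 (h.differentiableAt_form hS hx)]
  simp only [add_apply, smul_apply, ContinuousLinearMap.smulRight_apply, PiLp.add_apply,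
    PiLp.smul_apply, smul_eq_mul, h.fderiv_dens hS hρ hx, partialDeriv]

lemma fderiv_inner_coeff (h : IsSolution J ρ S ω Γ) (hS : IsOpen S) {x : E n} (hx : x ∈ S)
    (i : Fin n) : fderiv ℝ (fun y => (inner ℝ (Γ y) (ω y) : ℝ)) x (EuclideanSpace.single i 1)
      = ∑ j, (partialDeriv Γ x i j * ω x j + Γ x j * partialDeriv ω x i j) := by
  rw [fderiv_inner_apply ℝ (h.differentiableAt_coeff hS hx) (h.differentiableAt_form hS hx),
    inner_eq_sum, inner_eq_sum, Finset.sum_add_distrib, add_comm]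
  rfl

/-- The flux of `H` is `(ω · ∇) (ρ ω) + ρ (Q Γ - ⟨Γ, ω⟩ ω)`. -/
lemma flux_gradient_apply (h : IsSolution J ρ S ω Γ) (hS : IsOpen S) (hρ : IsDensity C c J ρ)
    (hc : 0 < c) {x : E n} (hx : x ∈ S) (k : Fin n) :
    (flux J ρ ω x (gradient (fun y => H J ρ (quad (ω y))) x)) k
      = ∑ i, ω x i * partialDeriv (fun y => ρ (quad (ω y)) • ω y) x i k
        + (ρ (quad (ω x)) * quad (ω x) * Γ x k
          - inner ℝ (Γ x) (ω x) * (ρ (quad (ω x)) * ω x k)) := by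
  have hH := (hρ.H'_pos hc (h.quad_mem x hx)).ne'
  have hP := h.fderiv_quad hS hx
  have hb := sum_mul_of_curl hP (h.curl_eq hx) k
  rw [flux_eq]
  simp only [h.partialDeriv_dens_smul hS hρ hx, PiLp.add_apply, PiLp.smul_apply, PiLp.sub_apply,
    smul_eq_mul, gradient_apply, inner_eq_sum, h.fderiv_H hS hρ hx]
  rw [← quad_eq_sum] at hb
  set P : Fin n → ℝ := fun i =>
    fderiv ℝ (fun y => quad (ω y)) x (EuclideanSpace.single i 1) with hPdef
  have e1 : ∑ i, ω x i * (ρ (quad (ω x)) * partialDeriv ω x i k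
      + dens' J ρ (quad (ω x)) * P i * ω x k)
      = ρ (quad (ω x)) * (∑ i, ω x i * partialDeriv ω x i k)
        + dens' J ρ (quad (ω x)) * (∑ i, ω x i * P i) * ω x k := by
    simp only [Finset.mul_sum, Finset.sum_mul, ← Finset.sum_add_distrib]
    exact Finset.sum_congr rfl fun i _ => by ring
  have e2 : ∑ i, ω x i * (H' J ρ (quad (ω x)) * P i)
      = H' J ρ (quad (ω x)) * ∑ i, ω x i * P i := by
    rw [Finset.mul_sum]
    exact Finset.sum_congr rfl fun i _ => by ring
  rw [e1, hb, e2]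
  have e3 : dens' J ρ (quad (ω x)) / H' J ρ (quad (ω x)) *
      (H' J ρ (quad (ω x)) * (∑ i, ω x i * P i) * ω x k
        - quad (ω x) * (H' J ρ (quad (ω x)) * P k))
      = dens' J ρ (quad (ω x)) * ((∑ i, ω x i * P i) * ω x k - quad (ω x) * P k) := by
    field_simp
  rw [e3]
  -- What remains is H'∇Q − Qρ'∇Q = ½ρ∇Q, the gradient part of ρ(ω·∇)ω.
  simp only [H']
  ring

end IsSolution

end WeakInequality

/-! ### The weak inequality for H on the punctured domain. -/

section WeakInequality

variable {n : ℕ} {C c : ℝ} {J : Set ℝ} {ρ : ℝ → ℝ} {S : Set (E n)} {ω Γ : E n → E n}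

namespace IsSolution

/-- The divergence of the flux of `H`, computed by the Bochner identity, is bounded below. -/
lemma neg_le_div_flux (h : IsSolution J ρ S ω Γ) (hS : IsOpen S) (hρ : IsDensity C c J ρ)
    (hc : 0 < c) {x : E n} (hx : x ∈ S) :
    -((n + 2) * (1 + 1 / (2 * min (1 / 2) c)) * potential Γ x * H J ρ (quad (ω x))) ≤
      (∑ i, ∑ k, partialDeriv ω x k i * partialDeriv (fun y => ρ (quad (ω y)) • ω y) x i k +
        ∑ i, ω x i * fderiv ℝ (fun y => -(ρ (quad (ω y)) * inner ℝ (Γ y) (ω y))) x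
          (EuclideanSpace.single i 1)) +
      ∑ k, fderiv ℝ (fun y => ρ (quad (ω y)) * quad (ω y) * Γ y k
          - inner ℝ (Γ y) (ω y) * (ρ (quad (ω y)) * ω y k)) x (EuclideanSpace.single k 1) := by
  have hω := h.differentiableAt_form hS hx
  have hΓ := h.differentiableAt_coeff hS hx
  have hq := h.differentiableAt_quad hS hx
  have hR := ((h.contDiffOn_dens hS hρ).contDiffAt (hS.mem_nhds hx)).differentiableAt one_ne_zero
  have hN : DifferentiableAt ℝ (fun y => (inner ℝ (Γ y) (ω y) : ℝ)) x := hΓ.inner ℝ hω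
  have hωk : ∀ k, DifferentiableAt ℝ (fun y => ω y k) x := fun k =>
    ((contDiffOn_coord h.smooth_form k).contDiffAt (hS.mem_nhds hx)).differentiableAt (by simp)
  have hΓk : ∀ k, DifferentiableAt ℝ (fun y => Γ y k) x := fun k =>
    ((contDiffOn_coord h.smooth_coeff k).contDiffAt (hS.mem_nhds hx)).differentiableAt (by simp)
  set P : Fin n → ℝ := fun i =>
    fderiv ℝ (fun y => quad (ω y)) x (EuclideanSpace.single i 1) with hPdef
  have hP : ∀ i, P i = 2 * ∑ j, partialDeriv ω x i j * ω x j := h.fderiv_quad hS hx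
  set r := ρ (quad (ω x)) with hr
  set r' := dens' J ρ (quad (ω x)) with hr'
  have hr0 : 0 < r := hρ.pos _ (h.quad_mem x hx)
  have hQ : ∑ i, ω x i ^ 2 = quad (ω x) := (quad_eq_sum _).symm
  have hNs : ∑ j, Γ x j * ω x j = inner ℝ (Γ x) (ω x) := (inner_eq_sum _ _).symm
  -- The second equation of the system as div(ρω) = −ρ⟨Γ,ω⟩; it yields the term r⟨Γ,ω⟩² of the
  -- Bochner identity.
  have hdivX : ∑ k, (r * partialDeriv ω x k k + r' * P k * ω x k)
      = -(r * inner ℝ (Γ x) (ω x)) := by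
    have := h.hodge x hx
    simp only [codiff, h.partialDeriv_dens_smul hS hρ hx] at this
    linarith
  have eD : ∀ i, fderiv ℝ (fun y => -(ρ (quad (ω y)) * inner ℝ (Γ y) (ω y))) x
      (EuclideanSpace.single i 1) = -(r' * P i * (∑ j, Γ x j * ω x j)
        + r * ∑ j, (partialDeriv Γ x i j * ω x j + Γ x j * partialDeriv ω x i j)) := fun i => by
    rw [fderiv_fun_neg, fderiv_fun_mul hR hN]
    simp only [neg_apply, add_apply, smul_apply, smul_eq_mul, h.fderiv_inner_coeff hS hx,
      h.fderiv_dens hS hρ hx, hNs]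
    ring
  have eY : ∀ k, fderiv ℝ (fun y => ρ (quad (ω y)) * quad (ω y) * Γ y k
      - inner ℝ (Γ y) (ω y) * (ρ (quad (ω y)) * ω y k)) x (EuclideanSpace.single k 1)
      = ((r' * (∑ j, ω x j ^ 2) + r) * P k * Γ x k
          + r * (∑ j, ω x j ^ 2) * partialDeriv Γ x k k)
        - r * ((∑ j, (partialDeriv Γ x k j * ω x j + Γ x j * partialDeriv ω x k j)) * ω x k)
        - (∑ j, Γ x j * ω x j) * (r * partialDeriv ω x k k + r' * P k * ω x k) := fun k => by
    rw [fderiv_fun_sub ((hR.fun_mul hq).fun_mul (hΓk k)) (hN.fun_mul (hR.fun_mul (hωk k))),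
      fderiv_fun_mul (hR.fun_mul hq) (hΓk k), fderiv_fun_mul hR hq,
      fderiv_fun_mul hN (hR.fun_mul (hωk k)), fderiv_fun_mul hR (hωk k)]
    simp only [sub_apply, add_apply, smul_apply, smul_eq_mul, h.fderiv_inner_coeff hS hx,
      h.fderiv_dens hS hρ hx, hNs, hQ, fderiv_coord hω, fderiv_coord hΓ]
    simp only [partialDeriv, hPdef]
    ring
  have key := bochner_identity (g := partialDeriv Γ x) hP (h.curl_eq hx) r r'
  have lower := bochner_lower_bound (g := partialDeriv Γ x) (γ := Γ x) hP (r' := r') hr0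
    (by
      have h1 := hρ.H'_pos hc (h.quad_mem x hx)
      rw [hQ]
      simp only [H', ← hr, ← hr'] at h1
      linarith)
  rw [← key] at lower
  simp only [eD, eY, h.partialDeriv_dens_smul hS hρ hx, Finset.sum_sub_distrib, ← Finset.mul_sum]
  rw [hdivX, hNs]
  rw [hNs] at lower
  have hK := hρ.mul_dens_le_H hc (h.quad_mem x hx)
  have hH := hρ.H_nonneg hc (h.quad_mem x hx)
  have hg : Real.sqrt (∑ i, ∑ j, partialDeriv Γ x i j ^ 2) ≤ potential Γ x :=
    le_add_of_nonneg_right (sq_nonneg _)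
  have hbound : (n + 2) * (r * (∑ i, ω x i ^ 2))
      * Real.sqrt (∑ i, ∑ j, partialDeriv Γ x i j ^ 2) ≤
      (n + 2) * (1 + 1 / (2 * min (1 / 2) c)) * potential Γ x * H J ρ (quad (ω x)) := by
    rw [hQ, mul_comm r]
    calc _ ≤ (n + 2) * ((1 + 1 / (2 * min (1 / 2) c)) * H J ρ (quad (ω x))) * potential Γ x := by
          gcongr
      _ = _ := by ring
  linarith

/-- The two parts of the flux are integrated separately: (ω·∇)(ρω) is merely continuous and needs
the weak divergence formula, while the remaining field is C¹ and admits ordinary integration by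
parts. The integrands then combine into the pointwise Bochner bound. -/
theorem integral_inner_flux_le (h : IsSolution J ρ S ω Γ) (hS : IsOpen S)
    (hρ : IsDensity C c J ρ) (hc : 0 < c) {φ : E n → ℝ} (hφ : IsTest S φ) (hφ0 : ∀ x, 0 ≤ φ x) :
    ∫ x, inner ℝ (flux J ρ ω x (gradient (fun y => H J ρ (quad (ω y))) x)) (gradient φ x) ≤
      ∫ x, ((n + 2) * (1 + 1 / (2 * min (1 / 2) c)) * potential Γ x) * H J ρ (quad (ω x))
        * φ x := by
  have hφ1 : ContDiff ℝ 1 φ := hφ.smooth.of_le (by exact_mod_cast le_top)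
  have hω1 : ContDiffOn ℝ 1 ω S := h.smooth_form.of_le (by exact_mod_cast le_top)
  have hΓ1 : ContDiffOn ℝ 1 Γ S := h.smooth_coeff.of_le (by exact_mod_cast le_top)
  have hq1 : ContDiffOn ℝ 1 (fun y => quad (ω y)) S :=
    h.contDiffOn_quad.of_le (by exact_mod_cast le_top)
  have hR := h.contDiffOn_dens hS hρ
  have hN : ContDiffOn ℝ 1 (fun y => (inner ℝ (Γ y) (ω y) : ℝ)) S := hΓ1.inner ℝ hω1
  have hX : ContDiffOn ℝ 1 (fun y => ρ (quad (ω y)) • ω y) S := hR.smul hω1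
  have hD : ContDiffOn ℝ 1 (fun y => -(ρ (quad (ω y)) * inner ℝ (Γ y) (ω y))) S :=
    (hR.mul hN).neg
  have hY : ∀ k, ContDiffOn ℝ 1 (fun y => ρ (quad (ω y)) * quad (ω y) * Γ y k
      - inner ℝ (Γ y) (ω y) * (ρ (quad (ω y)) * ω y k)) S := fun k =>
    ((hR.mul hq1).mul (contDiffOn_coord hΓ1 k)).sub (hN.mul (hR.mul (contDiffOn_coord hω1 k)))
  have I1 : ∀ u : E n → ℝ, ContinuousOn u S → Integrable (fun x => u x * φ x) := fun u hu =>
    integrable_mul_of_tsupport_subset hS hu hφ.smooth.continuous hφ.compact hφ.supp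
  have I2 : ∀ u : E n → ℝ, ContinuousOn u S → ∀ v, Integrable (fun x => u x * fderiv ℝ φ x v) :=
    fun u hu v => integrable_mul_of_tsupport_subset hS hu
      ((hφ1.continuous_fderiv one_ne_zero).clm_apply continuous_const)
      (hφ.compact.fderiv_apply (𝕜 := ℝ) v) ((tsupport_fderiv_apply_subset' φ v).trans hφ.supp)
  have hwk := integral_directional_deriv_mul_fderiv hS h.smooth_form hX hD (fun x hx => by
    have := h.hodge x hx
    simp only [codiff] at this
    linarith) hφ
  have hYk : ∀ k, ∫ x, (ρ (quad (ω x)) * quad (ω x) * Γ x k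
        - inner ℝ (Γ x) (ω x) * (ρ (quad (ω x)) * ω x k))
          * fderiv ℝ φ x (EuclideanSpace.single k 1)
      = -∫ x, fderiv ℝ (fun y => ρ (quad (ω y)) * quad (ω y) * Γ y k
        - inner ℝ (Γ y) (ω y) * (ρ (quad (ω y)) * ω y k)) x (EuclideanSpace.single k 1) * φ x :=
    fun k => integral_mul_fderiv_of_tsupport_subset hS (hY k) hφ1 hφ.compact hφ.supp _
  have cX := continuousOn_partialDeriv hS hX
  have cω := continuousOn_partialDeriv hS hω1
  have cωi : ∀ i, ContinuousOn (fun x => ω x i) S := fun i =>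
    (contDiffOn_coord hω1 i).continuousOn
  have cD : ∀ i : Fin n, ContinuousOn (fun x => fderiv ℝ (fun y => -(ρ (quad (ω y)) *
      inner ℝ (Γ y) (ω y))) x (EuclideanSpace.single i 1)) S :=
    fun i => continuousOn_fderiv_apply hS hD _
  have cY := fun k : Fin n =>
    continuousOn_fderiv_apply hS (hY k) (EuclideanSpace.single k (1 : ℝ))
  have c1 : ContinuousOn (fun x => ∑ i, ∑ k, partialDeriv ω x k i *
      partialDeriv (fun y => ρ (quad (ω y)) • ω y) x i k + ∑ i, ω x i *
      fderiv ℝ (fun y => -(ρ (quad (ω y)) * inner ℝ (Γ y) (ω y))) x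
        (EuclideanSpace.single i 1)) S :=
    (continuousOn_finsetSum _ fun i _ => continuousOn_finsetSum _ fun k _ =>
      (cω k i).mul (cX i k)).add (continuousOn_finsetSum _ fun i _ => (cωi i).mul (cD i))
  have c2 := continuousOn_finsetSum Finset.univ fun k _ => cY k
  have e1 : ∀ x, inner ℝ (flux J ρ ω x (gradient (fun y => H J ρ (quad (ω y))) x)) (gradient φ x)
      = (∑ i, ∑ k, ω x i * partialDeriv (fun y => ρ (quad (ω y)) • ω y) x i k
          * fderiv ℝ φ x (EuclideanSpace.single k 1))
        + ∑ k, (ρ (quad (ω x)) * quad (ω x) * Γ x k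
          - inner ℝ (Γ x) (ω x) * (ρ (quad (ω x)) * ω x k))
            * fderiv ℝ φ x (EuclideanSpace.single k 1) := fun x => by
    by_cases hx : x ∈ S
    · rw [inner_eq_sum, Finset.sum_comm, ← Finset.sum_add_distrib]
      refine Finset.sum_congr rfl fun k _ => ?_
      rw [h.flux_gradient_apply hS hρ hc hx, gradient_apply, add_mul, Finset.sum_mul]
    · have h0 : ∀ v, fderiv ℝ φ x v = 0 := fun v =>
        image_eq_zero_of_notMem_tsupport (f := fun x => fderiv ℝ φ x v) fun h' =>
          hx (hφ.supp (tsupport_fderiv_apply_subset' φ v h'))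
      simp [inner_eq_sum, h0]
  simp_rw [e1]
  rw [integral_add (integrable_finsetSum _ fun i _ => integrable_finsetSum _ fun k _ =>
      I2 (fun x => ω x i * partialDeriv (fun y => ρ (quad (ω y)) • ω y) x i k)
        ((cωi i).mul (cX i k)) _)
    (integrable_finsetSum _ fun k _ => I2 _ (hY k).continuousOn _), hwk,
    integral_finsetSum _ fun k _ => I2 _ (hY k).continuousOn _]
  simp_rw [hYk]
  rw [Finset.sum_neg_distrib, ← integral_finsetSum _ fun k _ => I1 _ (cY k), ← neg_add,
    ← integral_add (I1 _ c1) (integrable_finsetSum _ fun k _ => I1 _ (cY k)), ← integral_neg]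
  refine integral_mono (((I1 _ c1).add (integrable_finsetSum _ fun k _ => I1 _ (cY k))).neg)
    (I1 (fun x => ((n + 2) * (1 + 1 / (2 * min (1 / 2) c)) * potential Γ x)
      * H J ρ (quad (ω x))) ((continuousOn_const.mul (continuousOn_potential hS hΓ1)).mul
        (h.contDiffOn_H hS hρ).continuousOn)) fun x => ?_
  simp only [← Finset.sum_mul]
  rw [← add_mul, ← neg_mul]
  by_cases hx : x ∈ S
  · have := h.neg_le_div_flux hS hρ hc hx
    exact mul_le_mul_of_nonneg_right (by linarith) (hφ0 x)
  · have h0 : φ x = 0 := image_eq_zero_of_notMem_tsupport fun h' => hx (hφ.supp h')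
    simp [h0]

end IsSolution

end WeakInequality

/-! ### Test functions of class `C¹` -/

section Mollify

variable {n : ℕ}

lemma continuous_inner_of_tsupport_subset {S : Set (E n)} (hS : IsOpen S) {F G : E n → E n}
    (hF : ContinuousOn F S) (hG : Continuous G) (hs : tsupport G ⊆ S) :
    Continuous (fun x => (inner ℝ (F x) (G x) : ℝ)) := by
  have hsub : tsupport (fun x => (inner ℝ (F x) (G x) : ℝ)) ⊆ tsupport G :=
    closure_mono fun x hx => by
      contrapose! hx
      simp [Function.notMem_support.1 hx]
  exact continuous_of_tsupport fun x hx =>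
    (hF.continuousAt (hS.mem_nhds (hs (hsub hx)))).inner hG.continuousAt

lemma integrable_inner_of_tsupport_subset {S : Set (E n)} (hS : IsOpen S) {F G : E n → E n}
    (hF : ContinuousOn F S) (hG : Continuous G) (hc : HasCompactSupport G) (hs : tsupport G ⊆ S) :
    Integrable (fun x => (inner ℝ (F x) (G x) : ℝ)) :=
  (continuous_inner_of_tsupport_subset hS hF hG hs).integrable_of_hasCompactSupport
    (hc.mono fun x hx => by
      contrapose! hx
      simp [Function.notMem_support.1 hx])

/-- Mollification by a normalized nonnegative bump. The compact set is chosen before `δ`, so that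
errors can be integrated over a fixed set on which continuous coefficients are integrable. -/
lemma exists_smooth_approx {S : Set (E n)} (hS : IsOpen S) {φ : E n → ℝ} (hφ : ContDiff ℝ 1 φ)
    (hc : HasCompactSupport φ) (hs : tsupport φ ⊆ S) (hφ0 : ∀ x, 0 ≤ φ x) :
    ∃ K ⊆ S, IsCompact K ∧ tsupport φ ⊆ K ∧ ∀ δ > 0, ∃ ψ : E n → ℝ, IsTest S ψ ∧ (∀ x, 0 ≤ ψ x) ∧
      tsupport ψ ⊆ K ∧ (∀ x, |φ x - ψ x| ≤ δ) ∧ ∀ x, ‖gradient φ x - gradient ψ x‖ ≤ δ := by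
  obtain ⟨ε, hε, hεS⟩ := hc.isCompact.exists_cthickening_subset_open hS hs
  refine ⟨Metric.cthickening ε (tsupport φ), hεS, hc.isCompact.cthickening,
    Metric.self_subset_cthickening _, fun δ hδ => ?_⟩
  have hu1 : UniformContinuous φ := hc.uniformContinuous_of_continuous hφ.continuous
  have hu2 : UniformContinuous (fderiv ℝ φ) :=
    (hc.fderiv (𝕜 := ℝ)).uniformContinuous_of_continuous (hφ.continuous_fderiv one_ne_zero)
  obtain ⟨δ₁, hδ₁, h1⟩ := Metric.uniformContinuous_iff.1 hu1 δ hδ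
  obtain ⟨δ₂, hδ₂, h2⟩ := Metric.uniformContinuous_iff.1 hu2 δ hδ
  -- `ε` keeps the support inside the compact set; `δ₁` and `δ₂` bound the oscillation of φ and of
  -- its derivative over the mollification radius.
  set r := min ε (min δ₁ δ₂) with hr
  have hr0 : 0 < r := lt_min hε (lt_min hδ₁ hδ₂)
  let b : ContDiffBump (0 : E n) := ⟨r / 2, r, by positivity, by linarith⟩
  set ψ : E n → ℝ := convolution (b.normed volume) φ (ContinuousLinearMap.lsmul ℝ ℝ) volume with hψ
  have hbi : LocallyIntegrable (b.normed volume) (volume : Measure (E n)) :=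
    b.continuous_normed.locallyIntegrable
  have hψs : tsupport ψ ⊆ Metric.cthickening ε (tsupport φ) := by
    refine closure_minimal ?_ Metric.isClosed_cthickening
    refine (support_convolution_subset (L := ContinuousLinearMap.lsmul ℝ ℝ)
      (μ := (volume : Measure (E n)))).trans ?_
    rintro _ ⟨y, hy, z, hz, rfl⟩
    rw [b.support_normed_eq, mem_ball_zero_iff] at hy
    refine Metric.mem_cthickening_of_dist_le _ z _ _ (subset_tsupport _ hz) ?_
    simp only [dist_add_self_left]
    exact hy.le.trans (min_le_left _ _)
  have hψc : HasCompactSupport ψ := hc.isCompact.cthickening.of_isClosed_subset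
    (isClosed_tsupport _) hψs
  have hψd : ∀ x, fderiv ℝ ψ x =
      (convolution (b.normed volume) (fderiv ℝ φ) (ContinuousLinearMap.lsmul ℝ ℝ) volume) x := by
    intro x
    rw [(hc.hasFDerivAt_convolution_right (ContinuousLinearMap.lsmul ℝ ℝ) hbi hφ x).fderiv]
    rfl
  refine ⟨ψ, ⟨?_, hψc, hψs.trans hεS⟩, fun x => ?_, hψs, fun x => ?_, fun x => ?_⟩
  · exact b.hasCompactSupport_normed.contDiff_convolution_left _ b.contDiff_normed
      hφ.continuous.locallyIntegrable
  · exact integral_nonneg fun t => mul_nonneg (b.nonneg_normed t) (hφ0 _)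
  · rw [abs_sub_comm, ← Real.dist_eq]
    refine b.dist_normed_convolution_le hφ.continuous.aestronglyMeasurable fun y hy => ?_
    exact (h1 ((Metric.mem_ball.1 hy).trans_le
      ((min_le_right _ _).trans (min_le_left _ _)))).le
  · have e : gradient φ x - gradient ψ x
        = (InnerProductSpace.toDual ℝ (E n)).symm (fderiv ℝ φ x - fderiv ℝ ψ x) := by
      rw [map_sub]; rfl
    rw [e, LinearIsometryEquiv.norm_map, norm_sub_rev, ← dist_eq_norm, hψd]
    refine b.dist_normed_convolution_le
      (hφ.continuous_fderiv one_ne_zero).aestronglyMeasurable fun y hy => ?_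
    exact (h2 ((Metric.mem_ball.1 hy).trans_le
      ((min_le_right _ _).trans (min_le_right _ _)))).le

/-- A weak inequality tested by smooth functions may be tested by functions of class `C¹`. -/
lemma integral_inner_gradient_le_of_isTest {S : Set (E n)} (hS : IsOpen S) {F : E n → E n}
    {g : E n → ℝ} (hF : ContinuousOn F S) (hg : ContinuousOn g S)
    (hw : ∀ ψ, IsTest S ψ → (∀ x, 0 ≤ ψ x) →
      ∫ x, (inner ℝ (F x) (gradient ψ x) : ℝ) ≤ ∫ x, g x * ψ x)
    {φ : E n → ℝ} (hφ : ContDiff ℝ 1 φ) (hc : HasCompactSupport φ) (hs : tsupport φ ⊆ S)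
    (hφ0 : ∀ x, 0 ≤ φ x) :
    ∫ x, (inner ℝ (F x) (gradient φ x) : ℝ) ≤ ∫ x, g x * φ x := by
  obtain ⟨K, hKS, hK, hφK, happ⟩ := exists_smooth_approx hS hφ hc hs hφ0
  have hFK : IntegrableOn (fun x => ‖F x‖ + |g x|) K :=
    ((hF.norm.add hg.abs).mono hKS).integrableOn_compact hK
  have Ii : ∀ u : E n → ℝ, ContDiff ℝ 1 u → HasCompactSupport u → tsupport u ⊆ S →
      Integrable (fun x => (inner ℝ (F x) (gradient u x) : ℝ)) := fun u hu huc hus =>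
    integrable_inner_of_tsupport_subset hS hF (continuous_gradient hu)
      (huc.of_isClosed_subset (isClosed_tsupport _) (tsupport_gradient_subset u))
      ((tsupport_gradient_subset u).trans hus)
  have Ig : ∀ u : E n → ℝ, ContDiff ℝ 1 u → HasCompactSupport u → tsupport u ⊆ S →
      Integrable (fun x => g x * u x) := fun u hu huc hus =>
    integrable_mul_of_tsupport_subset hS hg hu.continuous huc hus
  have bound : ∀ δ > 0, (∫ x, (inner ℝ (F x) (gradient φ x) : ℝ)) - ∫ x, g x * φ x
      ≤ δ * ∫ x in K, (‖F x‖ + |g x|) := by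
    intro δ hδ
    obtain ⟨ψ, hψ, hψ0, hψK, h1, h2⟩ := happ δ hδ
    have hψ1 : ContDiff ℝ 1 ψ := hψ.smooth.of_le (by exact_mod_cast le_top)
    have h3 := hw ψ hψ hψ0
    calc _ ≤ ((∫ x, (inner ℝ (F x) (gradient φ x) : ℝ)) - ∫ x, g x * φ x)
          - ((∫ x, (inner ℝ (F x) (gradient ψ x) : ℝ)) - ∫ x, g x * ψ x) := by linarith
      _ = ∫ x, ((inner ℝ (F x) (gradient φ x) - g x * φ x)
          - (inner ℝ (F x) (gradient ψ x) - g x * ψ x)) := by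
        rw [integral_sub (f := fun x => (inner ℝ (F x) (gradient φ x) : ℝ) - g x * φ x)
          (g := fun x => (inner ℝ (F x) (gradient ψ x) : ℝ) - g x * ψ x)
          ((Ii φ hφ hc hs).sub (Ig φ hφ hc hs))
          ((Ii ψ hψ1 hψ.compact hψ.supp).sub (Ig ψ hψ1 hψ.compact hψ.supp)),
          integral_sub (Ii φ hφ hc hs) (Ig φ hφ hc hs),
          integral_sub (Ii ψ hψ1 hψ.compact hψ.supp) (Ig ψ hψ1 hψ.compact hψ.supp)]
      _ ≤ ∫ x, K.indicator (fun x => δ * (‖F x‖ + |g x|)) x := by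
        refine integral_mono (((Ii φ hφ hc hs).sub (Ig φ hφ hc hs)).sub
          ((Ii ψ hψ1 hψ.compact hψ.supp).sub (Ig ψ hψ1 hψ.compact hψ.supp)))
          ((integrable_indicator_iff hK.measurableSet).2 (hFK.const_mul δ)) fun x => ?_
        by_cases hx : x ∈ K
        · simp only [indicator_of_mem hx]
          have e : (inner ℝ (F x) (gradient φ x) - g x * φ x)
              - (inner ℝ (F x) (gradient ψ x) - g x * ψ x)
              = inner ℝ (F x) (gradient φ x - gradient ψ x) - g x * (φ x - ψ x) := by
            rw [inner_sub_right]; ring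
          rw [e]
          have h4 : inner ℝ (F x) (gradient φ x - gradient ψ x) ≤ ‖F x‖ * δ :=
            (real_inner_le_norm _ _).trans (by gcongr; exact h2 x)
          have h5 : -(g x * (φ x - ψ x)) ≤ |g x| * δ :=
            (neg_le_abs _).trans (by rw [abs_mul]; gcongr; exact h1 x)
          linarith
        · have z : ∀ u : E n → ℝ, tsupport u ⊆ K → u x = 0 ∧ gradient u x = 0 := fun u hu =>
            ⟨image_eq_zero_of_notMem_tsupport fun h => hx (hu h),
              image_eq_zero_of_notMem_tsupport fun h => hx (hu (tsupport_gradient_subset u h))⟩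
          simp [indicator_of_notMem hx, z φ hφK, z ψ hψK]
      _ = δ * ∫ x in K, (‖F x‖ + |g x|) := by
        rw [integral_indicator hK.measurableSet, integral_const_mul]
  have hM : 0 ≤ ∫ x in K, (‖F x‖ + |g x|) := integral_nonneg fun x => by positivity
  refine sub_nonpos.1 (le_of_forall_pos_le_add fun ε hε => ?_)
  -- The summand 1 avoids division by zero when the integral vanishes.
  refine (bound (ε / ((∫ x in K, (‖F x‖ + |g x|)) + 1)) (by positivity)).trans ?_
  rw [zero_add, div_mul_eq_mul_div, div_le_iff₀ (by positivity)]
  nlinarith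

end Mollify

/-! ### Cutoff functions at a point -/

section Cutoff

variable {n : ℕ}

/-- The bump function of which the cutoff functions are rescalings. -/
def cutoffBump (n : ℕ) : ContDiffBump (0 : E n) := ⟨1, 2, one_pos, one_lt_two⟩

/-- A function which vanishes near `p` and is `1` outside the ball of radius `2 / (k + 1)`. -/
def cutoff (p : E n) (k : ℕ) (x : E n) : ℝ := 1 - cutoffBump n (((k : ℝ) + 1) • (x - p))

lemma contDiff_cutoff (p : E n) (k : ℕ) : ContDiff ℝ (⊤ : ℕ∞) (cutoff p k) :=
  contDiff_const.sub ((cutoffBump n).contDiff.comp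
    (by fun_prop : ContDiff ℝ (⊤ : ℕ∞) fun x : E n => ((k : ℝ) + 1) • (x - p)))

lemma cutoff_nonneg (p : E n) (k : ℕ) (x : E n) : 0 ≤ cutoff p k x :=
  sub_nonneg.2 (cutoffBump n).le_one

lemma cutoff_le_one (p : E n) (k : ℕ) (x : E n) : cutoff p k x ≤ 1 :=
  sub_le_self _ (cutoffBump n).nonneg

lemma notMem_tsupport_cutoff (p : E n) (k : ℕ) : p ∉ tsupport (cutoff p k) := by
  rw [notMem_tsupport_iff_eventuallyEq]
  have hc : Filter.Tendsto (fun x : E n => ((k : ℝ) + 1) • (x - p)) (nhds p) (nhds 0) := by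
    have : Continuous (fun x : E n => ((k : ℝ) + 1) • (x - p)) := by fun_prop
    simpa using this.tendsto p
  filter_upwards [hc.eventually (cutoffBump n).eventuallyEq_one] with x hx
  simp only [Pi.one_apply] at hx
  simp [cutoff, hx]

lemma notMem_closedBall_smul {p x : E n} {k : ℕ}
    (hx : x ∉ Metric.closedBall p (2 / ((k : ℝ) + 1))) :
    ((k : ℝ) + 1) • (x - p) ∉ Metric.closedBall (0 : E n) 2 := by
  have hk : (0 : ℝ) < (k : ℝ) + 1 := by positivity
  rw [Metric.mem_closedBall, not_le, dist_eq_norm, div_lt_iff₀ hk] at hx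
  rw [mem_closedBall_zero_iff, not_le, norm_smul, Real.norm_of_nonneg hk.le]
  linarith

lemma cutoff_eq_one {p x : E n} {k : ℕ}
    (hx : x ∉ Metric.closedBall p (2 / ((k : ℝ) + 1))) : cutoff p k x = 1 := by
  have := notMem_closedBall_smul hx
  rw [cutoff, (cutoffBump n).zero_of_le_dist, sub_zero]
  exact (not_le.1 (fun h => this (Metric.mem_closedBall.2 h))).le

lemma tendsto_cutoff {p x : E n} (hx : x ≠ p) :
    Filter.Tendsto (fun k => cutoff p k x) Filter.atTop (nhds 1) := by
  refine tendsto_const_nhds.congr' ?_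
  have h2 : Filter.Tendsto (fun k : ℕ => 2 / ((k : ℝ) + 1)) Filter.atTop (nhds 0) :=
    tendsto_const_nhds.div_atTop (Filter.tendsto_atTop_add_const_right _ _
      tendsto_natCast_atTop_atTop)
  filter_upwards [h2.eventually_lt_const (dist_pos.2 hx)] with k hk
  exact (cutoff_eq_one (by simpa using hk)).symm

lemma fderiv_cutoff (p : E n) (k : ℕ) (x : E n) : fderiv ℝ (cutoff p k) x
    = -(((k : ℝ) + 1) • fderiv ℝ (cutoffBump n) (((k : ℝ) + 1) • (x - p))) := by
  have h1 : HasFDerivAt (fun x : E n => ((k : ℝ) + 1) • (x - p))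
      (((k : ℝ) + 1) • ContinuousLinearMap.id ℝ (E n)) x :=
    ((hasFDerivAt_id x).sub_const p).fun_const_smul _
  have h2 := (((cutoffBump n).contDiff (n := 1)).differentiable one_ne_zero
    (((k : ℝ) + 1) • (x - p))).hasFDerivAt
  have h3 := ((h2.comp x h1).const_sub 1).fderiv
  rw [show cutoff p k = fun x => 1 - ((cutoffBump n) ∘ fun x : E n => ((k : ℝ) + 1) • (x - p)) x
    from rfl, h3]
  ext v
  simp

lemma gradient_cutoff_eq_zero {p x : E n} {k : ℕ}
    (hx : x ∉ Metric.closedBall p (2 / ((k : ℝ) + 1))) : gradient (cutoff p k) x = 0 := by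
  have h0 : fderiv ℝ (cutoffBump n) (((k : ℝ) + 1) • (x - p)) = 0 :=
    image_eq_zero_of_notMem_tsupport fun h => notMem_closedBall_smul hx (by
      have := tsupport_fderiv_subset ℝ h
      rwa [(cutoffBump n).tsupport_eq] at this)
  rw [← norm_eq_zero, norm_gradient, fderiv_cutoff, h0]
  simp

/-- All cutoffs rescale one bump function, so `M` depends on neither the point nor `k`. -/
lemma exists_norm_gradient_cutoff_le (n : ℕ) : ∃ M : ℝ, 0 ≤ M ∧ ∀ (p : E n) (k : ℕ) (x : E n),
    ‖gradient (cutoff p k) x‖ ≤ M * ((k : ℝ) + 1) := by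
  obtain ⟨M, hM⟩ := ((cutoffBump n).hasCompactSupport.fderiv (𝕜 := ℝ)).exists_bound_of_continuous
    (((cutoffBump n).contDiff (n := 1)).continuous_fderiv one_ne_zero)
  refine ⟨M, (norm_nonneg _).trans (hM 0), fun p k x => ?_⟩
  rw [norm_gradient, fderiv_cutoff, norm_neg, norm_smul, Real.norm_of_nonneg (by positivity),
    mul_comm]
  gcongr
  exact hM _

end Cutoff

/-! ### Removing the singular point -/

section Removable

variable {n : ℕ}

lemma ae_ne_point (hn : 2 < n) (p : E n) : ∀ᵐ x ∂(volume : Measure (E n)), x ≠ p := by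
  have : Nonempty (Fin n) := ⟨⟨0, by omega⟩⟩
  rw [ae_iff]
  simp

lemma aestronglyMeasurable_of_continuousOn_diff {V : Type*} [NormedAddCommGroup V]
    [SecondCountableTopology V] (hn : 2 < n) {Ω U : Set (E n)} {p : E n} {g : E n → V}
    (hg : ContinuousOn g (Ω \ {p})) (hU : MeasurableSet U) (hUΩ : U ⊆ Ω) :
    AEStronglyMeasurable g (volume.restrict U) := by
  have : Nonempty (Fin n) := ⟨⟨0, by omega⟩⟩
  have h1 : (U \ {p} : Set (E n)) =ᵐ[volume] U := sdiff_null_ae_eq_self (measure_singleton p)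
  rw [← Measure.restrict_congr_set h1]
  exact (hg.mono (sdiff_subset_sdiff_left hUΩ)).aestronglyMeasurable
    (hU.diff (measurableSet_singleton p))

/-- This pairing matches H² with both the potential and |∇cutoff|². -/
lemma holderConjugate_half {n : ℕ} (hn : 2 < n) :
    Real.HolderConjugate ((n : ℝ) / (n - 2)) ((n : ℝ) / 2) := by
  have h2 : (2 : ℝ) < n := by exact_mod_cast hn
  rw [Real.holderConjugate_iff]
  refine ⟨?_, ?_⟩
  · rw [lt_div_iff₀ (by linarith)]; linarith
  · have : (n : ℝ) - 2 ≠ 0 := by linarith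
    field_simp
    ring

lemma memLp_sq {α : Type*} [MeasurableSpace α] {μ : Measure α} (hn : 2 < n) {h : α → ℝ}
    (hh : MemLp h (ENNReal.ofReal (2 * (n : ℝ) / ((n : ℝ) - 2))) μ) :
    MemLp (fun x => h x ^ 2) (ENNReal.ofReal ((n : ℝ) / ((n : ℝ) - 2))) μ := by
  have h2 : (2 : ℝ) < n := by exact_mod_cast hn
  have h3 : (0 : ℝ) < n - 2 := by linarith
  have : ENNReal.HolderTriple (ENNReal.ofReal (2 * (n : ℝ) / ((n : ℝ) - 2)))
      (ENNReal.ofReal (2 * (n : ℝ) / ((n : ℝ) - 2))) (ENNReal.ofReal ((n : ℝ) / ((n : ℝ) - 2))) := by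
    constructor
    rw [← ENNReal.ofReal_inv_of_pos (by positivity), ← ENNReal.ofReal_inv_of_pos (by positivity),
      ← ENNReal.ofReal_add (by positivity) (by positivity)]
    congr 1
    field_simp
    ring
  simpa only [sq] using MemLp.mul' hh hh

lemma integrable_mul_sq {α : Type*} [MeasurableSpace α] {μ : Measure α} (hn : 2 < n)
    {f h : α → ℝ} (hf : MemLp f (ENNReal.ofReal ((n : ℝ) / 2)) μ)
    (hh : MemLp h (ENNReal.ofReal (2 * (n : ℝ) / ((n : ℝ) - 2))) μ) :
    Integrable (fun x => f x * h x ^ 2) μ := by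
  have := (holderConjugate_half hn).symm.ennrealOfReal
  exact hf.integrable_mul (memLp_sq hn hh)

lemma norm_gradient_cutoff_sq_le {M : ℝ}
    (hM : ∀ (p : E n) (k : ℕ) (x : E n), ‖gradient (cutoff p k) x‖ ≤ M * ((k : ℝ) + 1))
    (p : E n) (k : ℕ) (x : E n) : ‖gradient (cutoff p k) x‖ ^ 2 ≤
      (Metric.closedBall p (2 / ((k : ℝ) + 1))).indicator
        (fun _ => (M * ((k : ℝ) + 1)) ^ 2) x := by
  by_cases hx : x ∈ Metric.closedBall p (2 / ((k : ℝ) + 1))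
  · rw [indicator_of_mem hx]
    have := hM p k x
    gcongr
  · rw [indicator_of_notMem hx, gradient_cutoff_eq_zero hx]
    simp

/-- By scale invariance of the L^{n/2} norm of |∇cutoff|²: the gradient is at most M(k+1) on a ball
of radius 2/(k+1), so the n-th powers of k+1 cancel. Hölder's inequality against h² does the rest.
-/
lemma exists_integral_sq_mul_norm_gradient_cutoff_le (hn : 2 < n) (p : E n) {A : Set (E n)}
    {h : E n → ℝ}
    (hh : MemLp h (ENNReal.ofReal (2 * (n : ℝ) / ((n : ℝ) - 2))) (volume.restrict A))
    (hh2 : IntegrableOn (fun x => h x ^ 2) A) :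
    ∃ B : ℝ, ∀ k : ℕ,
      IntegrableOn (fun x => h x ^ 2 * ‖gradient (cutoff p k) x‖ ^ 2) A ∧
      ∫ x in A, h x ^ 2 * ‖gradient (cutoff p k) x‖ ^ 2 ≤ B := by
  obtain ⟨M, hM0, hM⟩ := exists_norm_gradient_cutoff_le n
  have h2 : (2 : ℝ) < n := by exact_mod_cast hn
  set v := (volume : Measure (E n)).real (Metric.ball 0 1)
  refine ⟨(∫ x in A, (h x ^ 2) ^ ((n : ℝ) / (n - 2))) ^ (1 / ((n : ℝ) / (n - 2)))
    * ((2 * M) ^ n * v) ^ (1 / ((n : ℝ) / 2)), fun k => ?_⟩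
  set D := Metric.closedBall p (2 / ((k : ℝ) + 1)) with hD
  have hk : (0 : ℝ) < (k : ℝ) + 1 := by positivity
  set g : E n → ℝ := D.indicator (fun _ => (M * ((k : ℝ) + 1)) ^ 2) with hg
  have hDm : MeasurableSet D := Metric.isClosed_closedBall.measurableSet
  have hDf : (volume.restrict A) D ≠ ∞ :=
    ((Measure.restrict_apply_le A D).trans_lt measure_closedBall_lt_top).ne
  have hg0 : ∀ x, 0 ≤ g x := fun x => indicator_nonneg (fun _ _ => by positivity) x
  have hgL : ∀ q, MemLp g q (volume.restrict A) := fun q =>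
    memLp_indicator_const q hDm _ (Or.inr hDf)
  have hpow : ∀ x, g x ^ ((n : ℝ) / 2) = D.indicator (fun _ => (M * ((k : ℝ) + 1)) ^ n) x := by
    intro x
    by_cases hx : x ∈ D
    · simp only [hg, indicator_of_mem hx]
      rw [← Real.rpow_natCast _ 2, ← Real.rpow_mul (by positivity), ← Real.rpow_natCast]
      congr 1
      push_cast
      ring
    · simp only [hg, indicator_of_notMem hx]
      exact Real.zero_rpow (by positivity)
  have hgint : ∫ x in A, g x ^ ((n : ℝ) / 2) ≤ (2 * M) ^ n * v := by
    simp_rw [hpow]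
    rw [integral_indicator hDm, setIntegral_const]
    have e : volume.real D = (2 / ((k : ℝ) + 1)) ^ n * v := by
      rw [hD, Measure.addHaar_real_closedBall _ _ (by positivity), finrank_euclideanSpace_fin]
    have e2 : (volume.restrict A).real D ≤ volume.real D :=
      ENNReal.toReal_mono measure_closedBall_lt_top.ne (Measure.restrict_apply_le A D)
    calc _ ≤ volume.real D • (M * ((k : ℝ) + 1)) ^ n := by
          simp only [smul_eq_mul]
          gcongr
      _ = (2 * M) ^ n * v := by
          rw [e, smul_eq_mul, mul_right_comm, ← mul_pow]
          congr 2
          field_simp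
  have hle : ∀ x, h x ^ 2 * ‖gradient (cutoff p k) x‖ ^ 2 ≤ h x ^ 2 * g x := fun x =>
    mul_le_mul_of_nonneg_left (norm_gradient_cutoff_sq_le hM p k x) (sq_nonneg _)
  have hconj := holderConjugate_half hn
  have := hconj.ennrealOfReal
  have hint : IntegrableOn (fun x => h x ^ 2 * g x) A :=
    (memLp_sq hn hh).integrable_mul (hgL (ENNReal.ofReal ((n : ℝ) / 2)))
  have hint2 : IntegrableOn (fun x => h x ^ 2 * ‖gradient (cutoff p k) x‖ ^ 2) A := by
    refine hint.mono' (hh2.1.mul ?_) (.of_forall fun x => ?_)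
    · exact ((continuous_gradient ((contDiff_cutoff p k).of_le
        (by exact_mod_cast le_top))).norm.pow 2).aestronglyMeasurable
    · rw [Real.norm_of_nonneg (by positivity)]
      exact hle x
  refine ⟨hint2, (integral_mono hint2 hint hle).trans ?_⟩
  refine (integral_mul_le_Lp_mul_Lq_of_nonneg hconj (.of_forall fun x => sq_nonneg _)
    (.of_forall hg0) (memLp_sq hn hh) (hgL _)).trans ?_
  have hn0 : 0 ≤ (1 : ℝ) / (n / 2) := by positivity
  have hI0 : 0 ≤ ∫ x in A, g x ^ ((n : ℝ) / 2) :=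
    integral_nonneg fun x => Real.rpow_nonneg (hg0 x) _
  have hI1 : 0 ≤ ∫ x in A, (h x ^ 2) ^ ((n : ℝ) / (n - 2)) :=
    integral_nonneg fun x => Real.rpow_nonneg (sq_nonneg _) _
  exact mul_le_mul_of_nonneg_left (Real.rpow_le_rpow hI0 hgint hn0) (Real.rpow_nonneg hI1 _)

lemma memLp_gradient_cutoff (p : E n) (k : ℕ) (q : ℝ≥0∞) :
    MemLp (gradient (cutoff p k)) q volume := by
  have hc : Continuous (gradient (cutoff p k)) :=
    continuous_gradient ((contDiff_cutoff p k).of_le (by exact_mod_cast le_top))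
  refine hc.memLp_of_hasCompactSupport (HasCompactSupport.intro
    (isCompact_closedBall p (2 / ((k : ℝ) + 1))) fun x hx => gradient_cutoff_eq_zero hx)

/-- Zero capacity of a point: the Dirichlet integral scales like (k+1)^{2−n}, and n > 2. -/
lemma tendsto_integral_norm_gradient_cutoff_sq (hn : 2 < n) (p : E n) (U : Set (E n)) :
    Filter.Tendsto (fun k => ∫ x in U, ‖gradient (cutoff p k) x‖ ^ 2) Filter.atTop (nhds 0) := by
  obtain ⟨M, hM0, hM⟩ := exists_norm_gradient_cutoff_le n
  set v := (volume : Measure (E n)).real (Metric.ball 0 1)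
  have h2 : Filter.Tendsto (fun k : ℕ => 2 / ((k : ℝ) + 1)) Filter.atTop (nhds 0) :=
    tendsto_const_nhds.div_atTop (Filter.tendsto_atTop_add_const_right _ _
      tendsto_natCast_atTop_atTop)
  have h3 : Filter.Tendsto (fun k : ℕ => (2 * M) ^ 2 * (2 / ((k : ℝ) + 1)) ^ (n - 2) * v)
      Filter.atTop (nhds 0) := by
    have := ((h2.pow (n - 2)).const_mul ((2 * M) ^ 2)).mul_const v
    rwa [zero_pow (by omega), mul_zero, zero_mul] at this
  refine squeeze_zero (fun k => integral_nonneg fun x => sq_nonneg _) (fun k => ?_) h3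
  have hk : (0 : ℝ) < (k : ℝ) + 1 := by positivity
  have hi : Integrable (fun x => ‖gradient (cutoff p k) x‖ ^ 2) volume :=
    (memLp_gradient_cutoff p k 2).integrable_norm_pow two_ne_zero
  have hDm : MeasurableSet (Metric.closedBall p (2 / ((k : ℝ) + 1))) :=
    Metric.isClosed_closedBall.measurableSet
  calc _ ≤ ∫ x, ‖gradient (cutoff p k) x‖ ^ 2 :=
        setIntegral_le_integral hi (.of_forall fun x => sq_nonneg _)
    _ ≤ ∫ x, (Metric.closedBall p (2 / ((k : ℝ) + 1))).indicator
        (fun _ => (M * ((k : ℝ) + 1)) ^ 2) x := by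
      refine integral_mono hi ?_ (norm_gradient_cutoff_sq_le hM p k)
      exact (integrable_indicator_iff hDm).2
        (integrableOn_const measure_closedBall_lt_top.ne)
    _ = _ := by
      rw [integral_indicator hDm, setIntegral_const, smul_eq_mul,
        Measure.addHaar_real_closedBall _ _ (by positivity), finrank_euclideanSpace_fin]
      obtain ⟨m, rfl⟩ : ∃ m, n = m + 2 := ⟨n - 2, by omega⟩
      simp only [Nat.add_sub_cancel]
      rw [pow_add]
      field_simp
      exact mul_comm _ _

/-- By Cauchy–Schwarz. Every error term caused by differentiating a cutoff has this form. -/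
lemma tendsto_integral_inner_gradient_cutoff (hn : 2 < n) (p : E n) {U : Set (E n)}
    {V : E n → E n} (hV : MemLp V 2 (volume.restrict U)) :
    Filter.Tendsto (fun k => ∫ x in U, (inner ℝ (V x) (gradient (cutoff p k) x) : ℝ))
      Filter.atTop (nhds 0) := by
  have h2 : ENNReal.ofReal 2 = 2 := by simp
  have h0 := (tendsto_integral_norm_gradient_cutoff_sq hn p U).rpow_const
    (p := (1 / 2 : ℝ)) (Or.inr (by norm_num))
  have h1 := h0.const_mul ((∫ x in U, ‖V x‖ ^ (2 : ℝ)) ^ (1 / 2 : ℝ))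
  rw [Real.zero_rpow (by norm_num), mul_zero] at h1
  have hk2 := fun k => (memLp_gradient_cutoff p k 2).restrict U
  refine squeeze_zero_norm (fun k => ?_) h1
  have hi : IntegrableOn (fun x => ‖V x‖ * ‖gradient (cutoff p k) x‖) U :=
    hV.norm.integrable_mul (hk2 k).norm
  calc _ ≤ ∫ x in U, ‖V x‖ * ‖gradient (cutoff p k) x‖ :=
        norm_integral_le_of_norm_le hi (.of_forall fun x => norm_inner_le_norm _ _)
    _ ≤ _ := by
      have := integral_mul_norm_le_Lp_mul_Lq (μ := volume.restrict U) Real.HolderConjugate.two_two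
        (by rwa [h2] : MemLp V (ENNReal.ofReal 2) _)
        (by rw [h2]; exact hk2 k : MemLp (gradient (cutoff p k)) (ENNReal.ofReal 2) _)
      simpa using this

lemma tendsto_integral_mul_cutoff (hn : 2 < n) (p : E n) {U : Set (E n)} {g : E n → ℝ}
    (hg : IntegrableOn g U) :
    Filter.Tendsto (fun k => ∫ x in U, g x * cutoff p k x) Filter.atTop
      (nhds (∫ x in U, g x)) := by
  refine tendsto_integral_of_dominated_convergence (fun x => ‖g x‖)
    (fun k => hg.1.mul (contDiff_cutoff p k).continuous.aestronglyMeasurable) hg.norm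
    (fun k => .of_forall fun x => ?_) ?_
  · rw [norm_mul, Real.norm_of_nonneg (cutoff_nonneg p k x)]
    exact mul_le_of_le_one_right (norm_nonneg _) (cutoff_le_one p k x)
  · filter_upwards [ae_restrict_of_ae (ae_ne_point hn p)] with x hx
    simpa using (tendsto_cutoff hx).const_mul (g x)

lemma gradient_fun_mul {u v : E n → ℝ} {x : E n} (hu : DifferentiableAt ℝ u x)
    (hv : DifferentiableAt ℝ v x) :
    gradient (fun y => u y * v y) x = u x • gradient v x + v x • gradient u x := by
  ext i
  simp only [PiLp.add_apply, PiLp.smul_apply, gradient_apply, fderiv_fun_mul hu hv, add_apply,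
    smul_apply]

end Removable

/-! ### Caccioppoli's estimate and square integrability of the gradient. -/

section Removable

/-- Fatou's lemma; integrability of the limit is a conclusion, so dominated convergence is not
available. -/
lemma integrable_of_tendsto_of_integral_le {α : Type*} [MeasurableSpace α] {μ : Measure α}
    {G : ℕ → α → ℝ} {g : α → ℝ} {B : ℝ} (hG : ∀ k, Integrable (G k) μ)
    (hG0 : ∀ k x, 0 ≤ G k x) (hB : ∀ k, ∫ x, G k x ∂μ ≤ B)
    (hlim : ∀ᵐ x ∂μ, Filter.Tendsto (fun k => G k x) Filter.atTop (nhds (g x))) :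
    Integrable g μ := by
  refine ⟨aestronglyMeasurable_of_tendsto_ae _ (fun k => (hG k).1) hlim, ?_⟩
  have h1 : ∫⁻ x, ‖g x‖ₑ ∂μ ≤ Filter.liminf (fun k => ∫⁻ x, ‖G k x‖ₑ ∂μ) Filter.atTop := by
    rw [lintegral_congr_ae (hlim.mono fun x hx => hx.enorm.liminf_eq.symm)]
    exact lintegral_liminf_le' fun k => (hG k).1.enorm
  refine (h1.trans (Filter.liminf_le_of_frequently_le' (x := ENNReal.ofReal B)
    (Filter.Frequently.of_forall fun k => ?_))).trans_lt ENNReal.ofReal_lt_top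
  have : ∫⁻ x, ‖G k x‖ₑ ∂μ = ENNReal.ofReal (∫ x, G k x ∂μ) := by
    rw [ofReal_integral_eq_lintegral_ofReal (hG k) (.of_forall (hG0 k))]
    exact lintegral_congr fun x => Real.enorm_of_nonneg (hG0 k x)
  rw [this]
  exact ENNReal.ofReal_le_ofReal (hB k)

variable {n : ℕ} {S : Set (E n)} {h f : E n → ℝ} {F : E n → E n} {l L : ℝ}

/-- The test function is hη², which is only C¹. Ellipticity bounds the main term below, and the
cross term 2hη⟨F,∇η⟩ is absorbed by Young's inequality. -/
lemma caccioppoli (hS : IsOpen S) (hl : 0 < l) (hh : ContDiffOn ℝ 1 h S)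
    (hh0 : ∀ x ∈ S, 0 ≤ h x) (hF : ContinuousOn F S)
    (hFle : ∀ x ∈ S, ‖F x‖ ≤ L * ‖gradient h x‖)
    (hFge : ∀ x ∈ S, l * ‖gradient h x‖ ^ 2 ≤ inner ℝ (F x) (gradient h x))
    (hw : ∀ φ, ContDiff ℝ 1 φ → HasCompactSupport φ → tsupport φ ⊆ S → (∀ x, 0 ≤ φ x) →
      ∫ x, (inner ℝ (F x) (gradient φ x) : ℝ) ≤ ∫ x, f x * h x * φ x)
    {η : E n → ℝ} (hη : ContDiff ℝ 1 η) (hc : HasCompactSupport η) (hs : tsupport η ⊆ S) :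
    Integrable (fun x => η x ^ 2 * ‖gradient h x‖ ^ 2) ∧
    ∫ x, η x ^ 2 * ‖gradient h x‖ ^ 2 ≤ 2 / l * (∫ x, f x * h x ^ 2 * η x ^ 2)
      + 4 * L ^ 2 / l ^ 2 * ∫ x, h x ^ 2 * ‖gradient η x‖ ^ 2 := by
  have hη2 : ContDiff ℝ 1 (fun x => η x ^ 2) := hη.pow 2
  have hη2c : HasCompactSupport (fun x => η x ^ 2) := hc.comp_left (g := fun t : ℝ => t ^ 2) (by simp)
  have hη2s : tsupport (fun x => η x ^ 2) ⊆ S := by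
    refine (closure_mono fun x hx => ?_).trans hs
    contrapose! hx
    simp [Function.notMem_support.1 hx]
  have hgc : HasCompactSupport (gradient η) :=
    hc.of_isClosed_subset (isClosed_tsupport _) (tsupport_gradient_subset η)
  have hg2c : HasCompactSupport (fun x => ‖gradient η x‖ ^ 2) :=
    hgc.comp_left (g := fun t : E n => ‖t‖ ^ 2) (by simp)
  have hg2s : tsupport (fun x => ‖gradient η x‖ ^ 2) ⊆ S := by
    refine (closure_mono fun x hx => ?_).trans ((tsupport_gradient_subset η).trans hs)
    contrapose! hx
    simp [Function.notMem_support.1 hx]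
  set φ : E n → ℝ := fun x => h x * η x ^ 2 with hφ
  have hφ1 : ContDiff ℝ 1 φ := contDiff_mul_of_tsupport_subset hS hh hη2 hη2s
  have hφc : HasCompactSupport φ := hη2c.mul_left
  have hφs : tsupport φ ⊆ S := tsupport_mul_subset_right.trans hη2s
  have hηz : ∀ x ∉ S, η x = 0 := fun x hx => image_eq_zero_of_notMem_tsupport fun h' => hx (hs h')
  have hφ0 : ∀ x, 0 ≤ φ x := fun x => by
    by_cases hx : x ∈ S
    · exact mul_nonneg (hh0 x hx) (sq_nonneg _)
    · simp [hφ, hηz x hx]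
  have hgrad : ContinuousOn (gradient h) S := continuousOn_gradient hS hh
  have I1 : Integrable (fun x => η x ^ 2 * ‖gradient h x‖ ^ 2) := by
    simp_rw [mul_comm (η _ ^ 2)]
    exact integrable_mul_of_tsupport_subset hS (hgrad.norm.pow 2) hη2.continuous hη2c hη2s
  have I2 : Integrable (fun x => h x ^ 2 * ‖gradient η x‖ ^ 2) :=
    integrable_mul_of_tsupport_subset hS (hh.continuousOn.pow 2)
      ((continuous_gradient hη).norm.pow 2) hg2c hg2s
  have I3 : Integrable (fun x => (inner ℝ (F x) (gradient φ x) : ℝ)) :=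
    integrable_inner_of_tsupport_subset hS hF (continuous_gradient hφ1)
      (hφc.of_isClosed_subset (isClosed_tsupport _) (tsupport_gradient_subset φ))
      ((tsupport_gradient_subset φ).trans hφs)
  refine ⟨I1, ?_⟩
  have hpt : ∀ x, l / 2 * (η x ^ 2 * ‖gradient h x‖ ^ 2)
      - 2 * L ^ 2 / l * (h x ^ 2 * ‖gradient η x‖ ^ 2) ≤ inner ℝ (F x) (gradient φ x) := by
    intro x
    by_cases hx : x ∈ S
    · have hhd : DifferentiableAt ℝ h x :=
        (hh.contDiffAt (hS.mem_nhds hx)).differentiableAt one_ne_zero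
      have hηd : DifferentiableAt ℝ η x := hη.differentiable one_ne_zero x
      have e : gradient φ x = (2 * h x * η x) • gradient η x + η x ^ 2 • gradient h x := by
        have : φ = fun y => h y * (η y * η y) := by ext y; simp only [hφ]; ring
        rw [this, gradient_fun_mul hhd (hηd.fun_mul hηd), gradient_fun_mul hηd hηd]
        module
      rw [e, inner_add_right, real_inner_smul_right, real_inner_smul_right]
      have h1 := mul_le_mul_of_nonneg_left (hFge x hx) (sq_nonneg (η x))
      have h2 : |(inner ℝ (F x) (gradient η x) : ℝ)| ≤ L * ‖gradient h x‖ * ‖gradient η x‖ :=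
        (abs_real_inner_le_norm _ _).trans (by gcongr; exact hFle x hx)
      have h3 : |2 * h x * η x * inner ℝ (F x) (gradient η x)|
          ≤ 2 * |h x| * |η x| * (L * ‖gradient h x‖ * ‖gradient η x‖) := by
        rw [abs_mul, abs_mul, abs_mul, abs_two]
        gcongr
      have h4 := (abs_le.1 h3).1
      have h5 : 2 * |h x| * |η x| * (L * ‖gradient h x‖ * ‖gradient η x‖)
          ≤ l / 2 * (η x ^ 2 * ‖gradient h x‖ ^ 2)
            + 2 * L ^ 2 / l * (h x ^ 2 * ‖gradient η x‖ ^ 2) := by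
        rw [← sq_abs (η x), ← sq_abs (h x)]
        -- Young's inequality as a square, weighted so that exactly half of the elliptic term l
        -- η²|∇h|² is spent.
        have h6 : 0 ≤ (l * (|η x| * ‖gradient h x‖) - 2 * L * (|h x| * ‖gradient η x‖)) ^ 2
            / (2 * l) := by positivity
        have h7 : (l * (|η x| * ‖gradient h x‖) - 2 * L * (|h x| * ‖gradient η x‖)) ^ 2
            / (2 * l) = l / 2 * (|η x| ^ 2 * ‖gradient h x‖ ^ 2)
            + 2 * L ^ 2 / l * (|h x| ^ 2 * ‖gradient η x‖ ^ 2)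
            - 2 * |h x| * |η x| * (L * ‖gradient h x‖ * ‖gradient η x‖) := by
          field_simp
          ring
        linarith
      linarith
    · have z1 : gradient η x = 0 := image_eq_zero_of_notMem_tsupport fun h' =>
        hx (hs (tsupport_gradient_subset η h'))
      have z2 : gradient φ x = 0 := image_eq_zero_of_notMem_tsupport fun h' =>
        hx (hφs (tsupport_gradient_subset φ h'))
      simp [hηz x hx, z1, z2]
  have hint := integral_mono ((I1.const_mul (l / 2)).sub (I2.const_mul (2 * L ^ 2 / l))) I3 hpt
  rw [integral_sub' (I1.const_mul (l / 2)) (I2.const_mul (2 * L ^ 2 / l)), integral_const_mul,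
    integral_const_mul] at hint
  have hwφ := hw φ hφ1 hφc hφs hφ0
  have e2 : ∫ x, f x * h x * φ x = ∫ x, f x * h x ^ 2 * η x ^ 2 := by
    refine integral_congr_ae (.of_forall fun x => ?_)
    simp only [hφ]
    ring
  rw [e2] at hwφ
  set a := ∫ x, η x ^ 2 * ‖gradient h x‖ ^ 2
  set b := ∫ x, h x ^ 2 * ‖gradient η x‖ ^ 2
  set d := ∫ x, f x * h x ^ 2 * η x ^ 2
  have h8 : l / 2 * a ≤ d + 2 * L ^ 2 / l * b := by linarith
  calc a = 2 / l * (l / 2 * a) := by field_simp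
    _ ≤ 2 / l * (d + 2 * L ^ 2 / l * b) := by gcongr
    _ = _ := by field_simp; ring

/-- Caccioppoli's estimate is applied to η = cutoff · χ, with χ a bump equal to 1 on the smaller
ball. Its right-hand side is bounded independently of `k`, and letting k → ∞ recovers the full
integral of |∇h|². -/
lemma memLp_gradient_of_weak (hn : 2 < n) {Ω : Set (E n)} {p : E n} {R : ℝ} (hR : 0 < R)
    (hΩ : IsOpen Ω) (hRΩ : Metric.closedBall p (2 * R) ⊆ Ω) (hl : 0 < l)
    (hh : ContDiffOn ℝ 1 h (Ω \ {p})) (hh0 : ∀ x ∈ Ω \ {p}, 0 ≤ h x)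
    (hf0 : ∀ x, 0 ≤ f x) (hF : ContinuousOn F (Ω \ {p}))
    (hFle : ∀ x ∈ Ω \ {p}, ‖F x‖ ≤ L * ‖gradient h x‖)
    (hFge : ∀ x ∈ Ω \ {p}, l * ‖gradient h x‖ ^ 2 ≤ inner ℝ (F x) (gradient h x))
    (hw : ∀ φ, ContDiff ℝ 1 φ → HasCompactSupport φ → tsupport φ ⊆ Ω \ {p} → (∀ x, 0 ≤ φ x) →
      ∫ x, (inner ℝ (F x) (gradient φ x) : ℝ) ≤ ∫ x, f x * h x * φ x)
    (hhL : MemLp h (ENNReal.ofReal (2 * (n : ℝ) / ((n : ℝ) - 2)))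
      (volume.restrict (Metric.closedBall p (2 * R))))
    (hh2 : IntegrableOn (fun x => h x ^ 2) (Metric.closedBall p (2 * R)))
    (hfh : IntegrableOn (fun x => f x * h x ^ 2) (Metric.closedBall p (2 * R))) :
    MemLp (gradient h) 2 (volume.restrict (Metric.ball p R)) := by
  have hS : IsOpen (Ω \ {p}) := hΩ.sdiff isClosed_singleton
  set A := Metric.closedBall p (2 * R) with hA
  have hAm : MeasurableSet A := Metric.isClosed_closedBall.measurableSet
  obtain ⟨B, hB⟩ := exists_integral_sq_mul_norm_gradient_cutoff_le hn p hhL hh2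
  obtain ⟨χ, hχin, hχout⟩ : ∃ χ : ContDiffBump p, χ.rIn = R ∧ χ.rOut = 2 * R :=
    ⟨⟨R, 2 * R, hR, by linarith⟩, rfl, rfl⟩
  have hχ0 : ∀ x, 0 ≤ χ x := fun _ => χ.nonneg
  have hχle : ∀ x, χ x ≤ 1 := fun _ => χ.le_one
  have hχ1 : ContDiff ℝ 1 χ := χ.contDiff
  have hχA : tsupport χ = A := by rw [χ.tsupport_eq, hχout]
  obtain ⟨m, hm⟩ := (χ.hasCompactSupport.fderiv (𝕜 := ℝ)).exists_bound_of_continuous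
    (hχ1.continuous_fderiv one_ne_zero)
  have hη : ∀ k, ContDiff ℝ 1 (fun x => cutoff p k x * χ x) := fun k =>
    ((contDiff_cutoff p k).of_le (by exact_mod_cast le_top)).mul hχ1
  have hηc : ∀ k, HasCompactSupport (fun x => cutoff p k x * χ x) := fun k =>
    χ.hasCompactSupport.mul_left
  have hηA : ∀ k, tsupport (fun x => cutoff p k x * χ x) ⊆ A := fun k =>
    tsupport_mul_subset_right.trans hχA.le
  have hηs : ∀ k, tsupport (fun x => cutoff p k x * χ x) ⊆ Ω \ {p} := fun k x hx =>
    ⟨hRΩ (hηA k hx), fun h' => notMem_tsupport_cutoff p k (by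
      have hx' : x ∈ tsupport (cutoff p k) := tsupport_mul_subset_left (g := χ) hx
      rwa [mem_singleton_iff.1 h'] at hx')⟩
  have hcac := fun k => caccioppoli hS hl hh hh0 hF hFle hFge hw (hη k) (hηc k) (hηs k)
  have hη1 : ∀ k x, (cutoff p k x * χ x) ^ 2 ≤ 1 := fun k x =>
    pow_le_one₀ (mul_nonneg (cutoff_nonneg p k x) (hχ0 x))
      (mul_le_one₀ (cutoff_le_one p k x) (hχ0 x) (hχle x))
  have bound1 : ∀ k, ∫ x, f x * h x ^ 2 * (cutoff p k x * χ x) ^ 2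
      ≤ ∫ x in A, f x * h x ^ 2 := by
    intro k
    rw [← integral_indicator hAm]
    refine integral_mono_of_nonneg
      (.of_forall fun x => mul_nonneg (mul_nonneg (hf0 x) (sq_nonneg _)) (sq_nonneg _))
      ((integrable_indicator_iff hAm).2 hfh) (.of_forall fun x => ?_)
    by_cases hx : x ∈ A
    · simp only [indicator_of_mem hx]
      exact mul_le_of_le_one_right (mul_nonneg (hf0 x) (sq_nonneg _)) (hη1 k x)
    · have : cutoff p k x * χ x = 0 :=
        image_eq_zero_of_notMem_tsupport (f := fun x => cutoff p k x * χ x)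
          fun h' => hx (hηA k h')
      simp [indicator_of_notMem hx, this]
  have hI : ∀ k, IntegrableOn (fun x => 2 * (h x ^ 2 * ‖gradient (cutoff p k) x‖ ^ 2)
      + 2 * m ^ 2 * h x ^ 2) A := fun k =>
    ((hB k).1.const_mul 2).add (hh2.const_mul (2 * m ^ 2))
  have bound2 : ∀ k, ∫ x, h x ^ 2 * ‖gradient (fun x => cutoff p k x * χ x) x‖ ^ 2
      ≤ 2 * B + 2 * m ^ 2 * ∫ x in A, h x ^ 2 := by
    intro k
    calc _ ≤ ∫ x in A, (2 * (h x ^ 2 * ‖gradient (cutoff p k) x‖ ^ 2)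
          + 2 * m ^ 2 * h x ^ 2) := by
          rw [← integral_indicator hAm]
          refine integral_mono_of_nonneg (.of_forall fun x => by positivity)
            ((integrable_indicator_iff hAm).2 (hI k)) (.of_forall fun x => ?_)
          by_cases hx : x ∈ A
          · simp only [indicator_of_mem hx]
            have hd1 : DifferentiableAt ℝ (cutoff p k) x :=
              (contDiff_cutoff p k).differentiable (by simp) x
            have hd2 : DifferentiableAt ℝ χ x := hχ1.differentiable one_ne_zero x
            rw [gradient_fun_mul hd1 hd2]
            have h1 : ‖cutoff p k x • gradient χ x‖ ≤ m := by
              rw [norm_smul, Real.norm_of_nonneg (cutoff_nonneg p k x), norm_gradient]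
              exact (mul_le_of_le_one_left (norm_nonneg _) (cutoff_le_one p k x)).trans (hm x)
            have h2 : ‖χ x • gradient (cutoff p k) x‖ ≤ ‖gradient (cutoff p k) x‖ := by
              rw [norm_smul, Real.norm_of_nonneg (hχ0 x)]
              exact mul_le_of_le_one_left (norm_nonneg _) (hχle x)
            have h3 : ‖cutoff p k x • gradient χ x + χ x • gradient (cutoff p k) x‖ ^ 2
                ≤ 2 * ‖gradient (cutoff p k) x‖ ^ 2 + 2 * m ^ 2 := by
              have h4 := (norm_add_le (cutoff p k x • gradient χ x)
                (χ x • gradient (cutoff p k) x)).trans (add_le_add h1 h2)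
              have h5 := pow_le_pow_left₀ (norm_nonneg _) h4 2
              nlinarith [sq_nonneg (m - ‖gradient (cutoff p k) x‖)]
            have h6 := mul_le_mul_of_nonneg_left h3 (sq_nonneg (h x))
            linarith
          · have : gradient (fun x => cutoff p k x * χ x) x = 0 :=
              image_eq_zero_of_notMem_tsupport fun h' =>
                hx (hηA k (tsupport_gradient_subset _ h'))
            simp [indicator_of_notMem hx, this]
      _ = 2 * (∫ x in A, h x ^ 2 * ‖gradient (cutoff p k) x‖ ^ 2)
          + 2 * m ^ 2 * ∫ x in A, h x ^ 2 := by
          rw [integral_add ((hB k).1.const_mul 2) (hh2.const_mul (2 * m ^ 2)),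
            integral_const_mul, integral_const_mul]
      _ ≤ _ := by linarith [(hB k).2]
  have hRA : Metric.ball p R ⊆ A :=
    Metric.ball_subset_closedBall.trans (Metric.closedBall_subset_closedBall (by linarith))
  have hmeas : AEStronglyMeasurable (gradient h) (volume.restrict (Metric.ball p R)) :=
    aestronglyMeasurable_of_continuousOn_diff hn (continuousOn_gradient hS hh)
      Metric.isOpen_ball.measurableSet (hRA.trans hRΩ)
  rw [memLp_two_iff_integrable_sq_norm hmeas]
  refine integrable_of_tendsto_of_integral_le
    (G := fun k x => (cutoff p k x * χ x) ^ 2 * ‖gradient h x‖ ^ 2)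
    (B := 2 / l * (∫ x in A, f x * h x ^ 2) + 4 * L ^ 2 / l ^ 2 *
      (2 * B + 2 * m ^ 2 * ∫ x in A, h x ^ 2))
    (fun k => (hcac k).1.integrableOn) (fun k x => by positivity) (fun k => ?_) ?_
  · refine (setIntegral_le_integral (hcac k).1 (.of_forall fun x => by positivity)).trans
      ((hcac k).2.trans ?_)
    have h1 := bound1 k
    have h2 := bound2 k
    gcongr
  · filter_upwards [ae_restrict_of_ae (ae_ne_point hn p),
      ae_restrict_mem Metric.isOpen_ball.measurableSet] with x hx hxR
    have h1 : χ x = 1 := χ.one_of_mem_closedBall (by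
      rw [hχin]; exact Metric.ball_subset_closedBall hxR)
    have h2 := ((tendsto_cutoff hx).pow 2).mul_const (‖gradient h x‖ ^ 2)
    simpa [h1] using h2

end Removable

/-! ### Extending the weak formulation across the point. -/

section Removable

variable {n : ℕ} {h f : E n → ℝ} {F : E n → E n} {l L : ℝ}

lemma IsTest.cutoff_mul {Ω U : Set (E n)} {φ : E n → ℝ} (hφ : IsTest U φ) (hU : U ⊆ Ω) (p : E n)
    (k : ℕ) : IsTest (Ω \ {p}) (fun x => cutoff p k x * φ x) where
  smooth := (contDiff_cutoff p k).mul hφ.smooth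
  compact := hφ.compact.mul_left
  supp x hx := ⟨hU (hφ.supp (tsupport_mul_subset_right hx)), fun h' =>
    notMem_tsupport_cutoff p k (by
      have hx' : x ∈ tsupport (cutoff p k) := tsupport_mul_subset_left (g := φ) hx
      rwa [mem_singleton_iff.1 h'] at hx')⟩

lemma IsTest.gradient_cutoff_mul {U : Set (E n)} {φ : E n → ℝ} (hφ : IsTest U φ) (p : E n)
    (k : ℕ) (x : E n) : gradient (fun x => cutoff p k x * φ x) x
      = cutoff p k x • gradient φ x + φ x • gradient (cutoff p k) x :=
  gradient_fun_mul ((contDiff_cutoff p k).differentiable (by simp) x)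
    (hφ.smooth.differentiable (by simp) x)

lemma IsTest.exists_bound {U : Set (E n)} {φ : E n → ℝ} (hφ : IsTest U φ) :
    ∃ m, ∀ x, ‖φ x‖ ≤ m ∧ ‖gradient φ x‖ ≤ m := by
  have hφ1 : ContDiff ℝ 1 φ := hφ.smooth.of_le (by exact_mod_cast le_top)
  obtain ⟨a, ha⟩ := hφ.compact.exists_bound_of_continuous hφ1.continuous
  obtain ⟨b, hb⟩ := (hφ.compact.fderiv (𝕜 := ℝ)).exists_bound_of_continuous
    (hφ1.continuous_fderiv one_ne_zero)
  refine ⟨max a b, fun x => ⟨(ha x).trans (le_max_left _ _), ?_⟩⟩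
  rw [norm_gradient]
  exact (hb x).trans (le_max_right _ _)

lemma IsTest.eq_zero {U : Set (E n)} {φ : E n → ℝ} (hφ : IsTest U φ) {x : E n} (hx : x ∉ U) :
    φ x = 0 ∧ gradient φ x = 0 :=
  ⟨image_eq_zero_of_notMem_tsupport fun h' => hx (hφ.supp h'),
    image_eq_zero_of_notMem_tsupport fun h' => hx (hφ.supp (tsupport_gradient_subset φ h'))⟩

lemma integrableOn_mul_cutoff (p : E n) (k : ℕ) {U : Set (E n)} {g : E n → ℝ}
    (hg : IntegrableOn g U) : IntegrableOn (fun x => g x * cutoff p k x) U :=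
  Integrable.mul_bdd (c := 1) hg (contDiff_cutoff p k).continuous.aestronglyMeasurable
    (.of_forall fun x => by
      rw [Real.norm_of_nonneg (cutoff_nonneg p k x)]
      exact cutoff_le_one p k x)

lemma integrableOn_inner_gradient_cutoff (p : E n) (k : ℕ) {U : Set (E n)} {V : E n → E n}
    (hV : MemLp V 2 (volume.restrict U)) :
    IntegrableOn (fun x => (inner ℝ (V x) (gradient (cutoff p k) x) : ℝ)) U :=
  have hk := (memLp_gradient_cutoff p k 2).restrict U
  Integrable.mono' (hV.norm.integrable_mul hk.norm) (hV.1.inner hk.1)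
    (.of_forall fun _ => norm_inner_le_norm _ _)

/-- The classical gradient off `p` carries no mass at `p`: integration by parts holds against cutoff
· φ, and the extra term is hφ paired with a derivative of the cutoff, which vanishes in the limit.
-/
lemma hasH12Gradient_of_punctured (hn : 2 < n) {Ω U : Set (E n)} {p : E n} (hΩ : IsOpen Ω)
    (hU : U ⊆ Ω) (hh : ContDiffOn ℝ 1 h (Ω \ {p}))
    (hh2 : MemLp h 2 (volume.restrict U)) (hg2 : MemLp (gradient h) 2 (volume.restrict U)) :
    HasH12Gradient U h (gradient h) := by
  have hS : IsOpen (Ω \ {p}) := hΩ.sdiff isClosed_singleton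
  refine ⟨hh2, hg2, fun φ hφ i => ?_⟩
  have hφ1 : ContDiff ℝ 1 φ := hφ.smooth.of_le (by exact_mod_cast le_top)
  obtain ⟨m, hm⟩ := hφ.exists_bound
  set e : E n := EuclideanSpace.single i 1 with he
  have hen : ‖e‖ = 1 := by simp [he]
  have hgc : Continuous (fun x => fderiv ℝ φ x e) :=
    (hφ1.continuous_fderiv one_ne_zero).clm_apply continuous_const
  have hφL : MemLp φ 2 (volume.restrict U) :=
    (hφ1.continuous.memLp_of_hasCompactSupport hφ.compact).restrict U
  have hdL : MemLp (fun x => fderiv ℝ φ x e) 2 (volume.restrict U) :=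
    (hgc.memLp_of_hasCompactSupport (hφ.compact.fderiv_apply (𝕜 := ℝ) e)).restrict U
  have hgiL : MemLp (fun x => gradient h x i) 2 (volume.restrict U) :=
    hg2.of_le_mul (c := 1)
      ((EuclideanSpace.proj (𝕜 := ℝ) i).continuous.comp_aestronglyMeasurable hg2.1)
      (.of_forall fun x => by rw [one_mul]; exact PiLp.norm_apply_le _ i)
  have I1 : IntegrableOn (fun x => h x * fderiv ℝ φ x e) U := hh2.integrable_mul hdL
  have I2 : IntegrableOn (fun x => gradient h x i * φ x) U := hgiL.integrable_mul hφL
  have hV : MemLp (fun x => (h x * φ x) • e) 2 (volume.restrict U) := by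
    refine hh2.of_le_mul (c := m)
      ((hh2.1.mul hφ1.continuous.aestronglyMeasurable).smul_const e) (.of_forall fun x => ?_)
    rw [norm_smul, hen, mul_one, norm_mul, mul_comm]
    gcongr
    exact (hm x).1
  have T1 := tendsto_integral_mul_cutoff hn p I1
  have T2 := (tendsto_integral_mul_cutoff hn p I2).neg
  have T3 := tendsto_integral_inner_gradient_cutoff hn p hV
  have T4 := T1.add T3
  rw [add_zero] at T4
  refine tendsto_nhds_unique T4 (T2.congr fun k => ?_)
  have hψ := hφ.cutoff_mul hU p k
  have key := integral_mul_fderiv_of_tsupport_subset (μ := volume) hS hh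
    (hψ.smooth.of_le (by exact_mod_cast le_top)) hψ.compact hψ.supp e
  have hd : ∀ x, fderiv ℝ (fun x => cutoff p k x * φ x) x e
      = cutoff p k x * fderiv ℝ φ x e + φ x * inner ℝ e (gradient (cutoff p k) x) := fun x => by
    rw [← inner_gradient_left, hφ.gradient_cutoff_mul, inner_add_left, real_inner_smul_left,
      real_inner_smul_left, inner_gradient_left, real_inner_comm]
  have e1 : ∫ x in U, gradient h x i * φ x * cutoff p k x
      = ∫ x, fderiv ℝ h x e * (cutoff p k x * φ x) := by
    rw [← setIntegral_eq_integral_of_forall_compl_eq_zero (s := U)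
      (f := fun x => fderiv ℝ h x e * (cutoff p k x * φ x)) fun x hx => by
        simp [(hφ.eq_zero hx).1]]
    refine integral_congr_ae (.of_forall fun x => ?_)
    simp only [gradient_apply, he]
    ring
  rw [e1, ← key, ← integral_add (integrableOn_mul_cutoff p k I1)
      (integrableOn_inner_gradient_cutoff p k hV),
    ← setIntegral_eq_integral_of_forall_compl_eq_zero (s := U)
      (f := fun x => h x * fderiv ℝ (fun x => cutoff p k x * φ x) x e) fun x hx => by
        simp only [hd, ← inner_gradient_left (f := φ), (hφ.eq_zero hx).1, (hφ.eq_zero hx).2]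
        simp]
  refine integral_congr_ae (.of_forall fun x => ?_)
  simp only [hd, real_inner_smul_left]
  ring

/-- Testing with cutoff · ζ adds only ∫ζ⟨F,∇cutoff⟩, which tends to 0 because ζF is square
integrable; the other integrals converge by domination. -/
lemma integral_inner_gradient_sub_le_of_punctured (hn : 2 < n) {Ω U : Set (E n)} {p : E n}
    (hU : U ⊆ Ω)
    (hw : ∀ ψ, IsTest (Ω \ {p}) ψ → (∀ x, 0 ≤ ψ x) →
      ∫ x, (inner ℝ (F x) (gradient ψ x) : ℝ) ≤ ∫ x, f x * ψ x)
    (hF2 : MemLp F 2 (volume.restrict U)) (hf1 : IntegrableOn f U)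
    {ζ : E n → ℝ} (hζ : IsTest U ζ) (hζ0 : ∀ x, 0 ≤ ζ x) :
    IntegrableOn (fun x => (inner ℝ (F x) (gradient ζ x) : ℝ)) U ∧
    IntegrableOn (fun x => f x * ζ x) U ∧
    ∫ x in U, ((inner ℝ (F x) (gradient ζ x) : ℝ) - f x * ζ x) ≤ 0 := by
  have hζ1 : ContDiff ℝ 1 ζ := hζ.smooth.of_le (by exact_mod_cast le_top)
  obtain ⟨m, hm⟩ := hζ.exists_bound
  have hgL : MemLp (gradient ζ) 2 (volume.restrict U) :=
    ((continuous_gradient hζ1).memLp_of_hasCompactSupport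
      (hζ.compact.of_isClosed_subset (isClosed_tsupport _) (tsupport_gradient_subset ζ))).restrict U
  have I1 : IntegrableOn (fun x => (inner ℝ (F x) (gradient ζ x) : ℝ)) U :=
    Integrable.mono' (hF2.norm.integrable_mul hgL.norm) (hF2.1.inner hgL.1)
      (.of_forall fun x => norm_inner_le_norm _ _)
  have I2 : IntegrableOn (fun x => f x * ζ x) U :=
    Integrable.mul_bdd (c := m) hf1 hζ1.continuous.aestronglyMeasurable (.of_forall fun x => (hm x).1)
  refine ⟨I1, I2, ?_⟩
  have hV : MemLp (fun x => ζ x • F x) 2 (volume.restrict U) := by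
    refine hF2.of_le_mul (c := m) (hζ1.continuous.aestronglyMeasurable.smul hF2.1)
      (.of_forall fun x => ?_)
    rw [norm_smul]
    gcongr
    exact (hm x).1
  have T1 := (tendsto_integral_mul_cutoff hn p I1).add
    (tendsto_integral_inner_gradient_cutoff hn p hV)
  have T2 := tendsto_integral_mul_cutoff hn p I2
  rw [add_zero] at T1
  rw [integral_sub I1 I2, sub_nonpos]
  refine le_of_tendsto_of_tendsto' T1 T2 fun k => ?_
  have key := hw _ (hζ.cutoff_mul hU p k) fun x => mul_nonneg (cutoff_nonneg p k x) (hζ0 x)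
  rw [← setIntegral_eq_integral_of_forall_compl_eq_zero (s := U)
      (f := fun x => (inner ℝ (F x) (gradient (fun x => cutoff p k x * ζ x) x) : ℝ)) fun x hx => by
        rw [hζ.gradient_cutoff_mul, (hζ.eq_zero hx).1, (hζ.eq_zero hx).2]; simp,
    ← setIntegral_eq_integral_of_forall_compl_eq_zero (s := U)
      (f := fun x => f x * (cutoff p k x * ζ x)) fun x hx => by
        rw [(hζ.eq_zero hx).1]; simp] at key
  rw [← integral_add (integrableOn_mul_cutoff p k I1) (integrableOn_inner_gradient_cutoff p k hV)]
  refine Eq.trans_le (integral_congr_ae (.of_forall fun x => ?_))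
    (key.trans_eq (integral_congr_ae (.of_forall fun x => ?_)))
  · simp only [hζ.gradient_cutoff_mul, inner_add_right, real_inner_smul_left,
      real_inner_smul_right]
    ring
  · simp only
    ring

theorem exists_isWeakSubsolution_of_punctured (hn : 2 < n) {Ω : Set (E n)} {p : E n}
    (hΩ : IsOpen Ω) (hp : p ∈ Ω) (hl : 0 < l)
    (hh : ContDiffOn ℝ 1 h (Ω \ {p})) (hh0 : ∀ x ∈ Ω \ {p}, 0 ≤ h x)
    (hf : ContinuousOn f (Ω \ {p})) (hf0 : ∀ x, 0 ≤ f x) {A : E n → E n → E n}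
    (hF : ContinuousOn (fun x => A x (gradient h x)) (Ω \ {p}))
    (hFle : ∀ x ∈ Ω \ {p}, ‖A x (gradient h x)‖ ≤ L * ‖gradient h x‖)
    (hFge : ∀ x ∈ Ω \ {p}, l * ‖gradient h x‖ ^ 2 ≤ inner ℝ (A x (gradient h x)) (gradient h x))
    (hw : ∀ ψ, IsTest (Ω \ {p}) ψ → (∀ x, 0 ≤ ψ x) →
      ∫ x, (inner ℝ (A x (gradient h x)) (gradient ψ x) : ℝ) ≤ ∫ x, f x * h x * ψ x)
    (hhL : MemLp h (ENNReal.ofReal (2 * (n : ℝ) / ((n : ℝ) - 2))) (volume.restrict Ω))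
    (hfL : MemLp f (ENNReal.ofReal ((n : ℝ) / 2)) (volume.restrict Ω)) :
    ∃ U : Set (E n), IsOpen U ∧ p ∈ U ∧ U ⊆ Ω ∧ IsWeakSubsolution U A f h := by
  have hS : IsOpen (Ω \ {p}) := hΩ.sdiff isClosed_singleton
  have h2 : (2 : ℝ) < n := by exact_mod_cast hn
  obtain ⟨r, hr, hrΩ⟩ := Metric.nhds_basis_closedBall.mem_iff.1 (hΩ.mem_nhds hp)
  set R := r / 2 with hRdef
  have hR : 0 < R := by positivity
  have hRΩ : Metric.closedBall p (2 * R) ⊆ Ω := by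
    rwa [hRdef, mul_div_cancel₀ r two_ne_zero]
  have hUB : Metric.ball p R ⊆ Metric.closedBall p (2 * R) :=
    Metric.ball_subset_closedBall.trans (Metric.closedBall_subset_closedBall (by linarith))
  have hUΩ := hUB.trans hRΩ
  have hUm : MeasurableSet (Metric.ball p R) := Metric.isOpen_ball.measurableSet
  have hfin : IsFiniteMeasure (volume.restrict (Metric.closedBall p (2 * R))) :=
    ⟨by simpa using measure_closedBall_lt_top⟩
  have hhB := hhL.mono_measure (Measure.restrict_mono hRΩ le_rfl)
  have hfB := hfL.mono_measure (Measure.restrict_mono hRΩ le_rfl)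
  have hh2 : MemLp h 2 (volume.restrict (Metric.closedBall p (2 * R))) := by
    refine hhB.mono_exponent ?_
    rw [show (2 : ℝ≥0∞) = ENNReal.ofReal 2 by simp]
    refine ENNReal.ofReal_le_ofReal ?_
    rw [le_div_iff₀ (by linarith)]
    linarith
  have hf1 : IntegrableOn f (Metric.closedBall p (2 * R)) := by
    refine memLp_one_iff_integrable.1 (hfB.mono_exponent ?_)
    rw [show (1 : ℝ≥0∞) = ENNReal.ofReal 1 by simp]
    exact ENNReal.ofReal_le_ofReal (by linarith)
  have hfh2 : IntegrableOn (fun x => f x * h x ^ 2) (Metric.closedBall p (2 * R)) :=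
    integrable_mul_sq hn hfB hhB
  have hfh : IntegrableOn (fun x => f x * h x) (Metric.ball p R) := by
    refine IntegrableOn.mono_set (t := Metric.closedBall p (2 * R))
      (Integrable.mono' (hf1.add hfh2) (hf1.1.mul hh2.1) (.of_forall fun x => ?_)) hUB
    rw [norm_mul, Real.norm_of_nonneg (hf0 x), Real.norm_eq_abs]
    -- This dominates f|h| by f + fh², both integrable on the larger ball.
    have h3 : |h x| ≤ 1 + h x ^ 2 := by
      rw [← sq_abs]
      nlinarith [sq_nonneg (|h x| - 1), abs_nonneg (h x)]
    have h4 := mul_le_mul_of_nonneg_left h3 (hf0 x)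
    simp only [Pi.add_apply]
    linarith
  have hG2 := memLp_gradient_of_weak hn hR hΩ hRΩ hl hh hh0 hf0 hF hFle hFge
    (fun φ hφ hc hs hφ0 => integral_inner_gradient_le_of_isTest hS hF (hf.mul hh.continuousOn) hw
      hφ hc hs hφ0) hhB (hh2.integrable_sq) hfh2
  have hF2 : MemLp (fun x => A x (gradient h x)) 2 (volume.restrict (Metric.ball p R)) := by
    refine hG2.of_le_mul (c := L) (aestronglyMeasurable_of_continuousOn_diff hn hF hUm hUΩ) ?_
    filter_upwards [ae_restrict_of_ae (ae_ne_point hn p), ae_restrict_mem hUm] with x hx hxU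
    exact hFle x ⟨hUΩ hxU, hx⟩
  refine ⟨Metric.ball p R, Metric.isOpen_ball, Metric.mem_ball_self hR, hUΩ, gradient h,
    hasH12Gradient_of_punctured hn hΩ hUΩ hh (hh2.mono_measure (Measure.restrict_mono hUB le_rfl))
      hG2, fun ζ hζ hζ0 => ?_⟩
  exact integral_inner_gradient_sub_le_of_punctured hn hUΩ hw hF2 hfh hζ hζ0

end Removable

end HodgeFrobenius

end

theorem theorem6 (n : ℕ) (hn : 2 < n) (C c : ℝ) (hC : 0 < C) (hc : 0 < c) :
    ∃ K : ℝ, 0 < K ∧ ∃ ε : ℝ, 0 < ε ∧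
      ∀ (J : Set ℝ) (ρ : ℝ → ℝ) (Ω : Set (HodgeFrobenius.E n)) (p : HodgeFrobenius.E n)
        (ω Γ : HodgeFrobenius.E n → HodgeFrobenius.E n),
        HodgeFrobenius.IsDensity C c J ρ →
        IsOpen Ω → p ∈ Ω →
        HodgeFrobenius.IsSolution J ρ (Ω \ {p}) ω Γ →
        MemLp (fun x => HodgeFrobenius.H J ρ (HodgeFrobenius.quad (ω x)))
          (ENNReal.ofReal (2 * (n : ℝ) / ((n : ℝ) - 2))) (volume.restrict Ω) →
        eLpNorm (HodgeFrobenius.potential Γ) (ENNReal.ofReal ((n : ℝ) / 2))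
          (volume.restrict Ω) ≤ ENNReal.ofReal ε →
        ∃ U : Set (HodgeFrobenius.E n), IsOpen U ∧ p ∈ U ∧ U ⊆ Ω ∧
          HodgeFrobenius.IsWeakSubsolution U (HodgeFrobenius.flux J ρ ω)
            (fun x => K * HodgeFrobenius.potential Γ x)
            (fun x => HodgeFrobenius.H J ρ (HodgeFrobenius.quad (ω x))) := by
  have hK : 0 < ((n : ℝ) + 2) * (1 + 1 / (2 * min (1 / 2) c)) := by positivity
  -- `K` is the Bochner factor n + 2 times the constant of ρQ ≤ const · H. The norm bound serves to
  -- place f in L^{n/2}, as H already has critical integrability; hence ε = 1 will do.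
  refine ⟨((n : ℝ) + 2) * (1 + 1 / (2 * min (1 / 2) c)), hK, 1, one_pos, ?_⟩
  intro J ρ Ω p ω Γ hρ hΩ hp hsol hH hf
  have hS : IsOpen (Ω \ {p}) := hΩ.sdiff isClosed_singleton
  have hH1 := hsol.contDiffOn_H hS hρ
  have hpot : ContinuousOn (HodgeFrobenius.potential Γ) (Ω \ {p}) :=
    HodgeFrobenius.continuousOn_potential hS
      (hsol.smooth_coeff.of_le (by exact_mod_cast le_top))
  exact HodgeFrobenius.exists_isWeakSubsolution_of_punctured hn hΩ hp
    (l := 1 / (2 * max (1 / 2) C)) (L := 1 / min (1 / 2) c + 1) (by positivity) hH1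
    (fun x hx => hρ.H_nonneg hc (hsol.quad_mem x hx)) (continuousOn_const.mul hpot)
    (fun x => mul_nonneg hK.le (HodgeFrobenius.potential_nonneg Γ x))
    (hsol.continuousOn_flux hρ hc (HodgeFrobenius.continuousOn_gradient hS hH1))
    (fun x hx => hρ.norm_flux_le hc (hsol.quad_mem x hx) _)
    (fun x hx => hρ.le_inner_flux hc (hsol.quad_mem x hx) _)
    (fun ψ hψ hψ0 => hsol.integral_inner_flux_le hS hρ hc hψ hψ0) hH
    (MemLp.const_mul ⟨HodgeFrobenius.aestronglyMeasurable_of_continuousOn_diff hn hpot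
      hΩ.measurableSet subset_rfl, hf.trans_lt ENNReal.ofReal_lt_top⟩ _)
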